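/- All graphs are finite and simple. Let $G$ be a connected graph with $|E(G)| = |V(G)| + 1$ (a bicyclic graph), and let $\Gamma = (G,\sigma)$ be a signed graph on $G$ with signature $\sigma : E(G) \to \{1,-1\}$. The spectrum of $\Gamma$ is the spectrum of the matrix $A(\Gamma)$ that has entry $\sigma(ij)$ if $ij \in E(G)$ and $0$ otherwise; it is called symmetric if for each eigenvalue $\lambda$ also $-\lambda$ is an eigenvalue with the same multiplicity. The sign of a cycle is $\sigma(C) = \prod_{e \in C}\sigma(e)$, and a cycle is even or odd according to its length. For a spanning tree $T$ of $G$, the spanning cycles of $G$ with respect to $T$ are the two cycles $C_1 \neq C_2$, each formed by one of the two edges $e \in E(G)\setminus E(T)$ together with edges of $T$. For a graph $H$ on $n$ vertices, $M(H,x) = \sum_{i=0}^{\lfloor n/2\rfloor} (-1)^i m_i(H) x^{n-2i}$ is its matching polynomial, where $m_i(H)$ is the number of sets of $i$ pairwise disjoint edges of $H$. $G - C$ is obtained from $G$ by deleting the vertices of $C$. Call $T$ admissible if its spanning cycles $C_1, C_2$ have lengths of the same parity or have no common edge. Then $G$ has an admissible spanning tree. Moreover, for every admissible spanning tree $T$ of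 $G$, with spanning cycles $C_1, C_2$, and every signature $\sigma$, the signed graph $\Gamma = (G,\sigma)$ has a symmetric spectrum if and only if one of the following holds: (i) $C_1$ and $C_2$ are both even; (ii) $C_1$ and $C_2$ are both odd, $M(G - C_1, x) = M(G - C_2, x)$, and $\sigma(C_1)\sigma(C_2) = -1$. -/

import Mathlib

namespace SignedSpectra

/-- `G` is `k`-cyclic: connected with `|E(G)| = |V(G)| + k - 1`. -/
def IsKCyclic {V : Type*} (G : SimpleGraph V) (k : ℕ) : Prop :=
  G.Connected ∧ G.edgeSet.ncard + 1 = Nat.card V + k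

/-- `T` is a spanning tree of `G` (its vertex set is all of `V`). -/
def IsSpanningTree {V : Type*} (G T : SimpleGraph V) : Prop :=
  T ≤ G ∧ T.IsTree

/-- `C` is the spanning cycle of `G` with respect to the spanning tree `T` and the edge
`e ∈ E(G) \ E(T)`: a cycle of `G` that consists of `e` and of edges of `T`. -/
def IsSpanningCycle {V : Type*} {G : SimpleGraph V} (T : SimpleGraph V) (e : Sym2 V)
    {u : V} (C : G.Walk u u) : Prop :=
  e ∉ T.edgeSet ∧ C.IsCycle ∧ e ∈ C.edges ∧ ∀ f ∈ C.edges, f = e ∨ f ∈ T.edgeSet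

/-- `C₁` and `C₂` are spanning cycles with respect to the same spanning tree `T` of `G`, formed by
two different edges outside `T`. -/
def IsSpanningCyclePair {V : Type*} {G : SimpleGraph V} (T : SimpleGraph V)
    {u₁ u₂ : V} (C₁ : G.Walk u₁ u₁) (C₂ : G.Walk u₂ u₂) : Prop :=
  IsSpanningTree G T ∧
    ∃ e₁ e₂ : Sym2 V, e₁ ≠ e₂ ∧ IsSpanningCycle T e₁ C₁ ∧ IsSpanningCycle T e₂ C₂

open Classical in
/-- The adjacency matrix of the signed graph `(G, σ)`, with signature `σ : E(G) → {1, -1}`. -/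
noncomputable def signedAdjMatrix {V : Type*} (G : SimpleGraph V) (σ : G.edgeSet → ℤˣ) :
    Matrix V V ℝ :=
  Matrix.of fun i j => if h : G.Adj i j then (((σ ⟨s(i, j), h⟩ : ℤˣ) : ℤ) : ℝ) else 0

/-- The spectrum of `(G, σ)`: the eigenvalues of the adjacency matrix with their multiplicities
(the matrix is real symmetric, so that all roots of its characteristic polynomial are real). -/
noncomputable def signedSpectrum {V : Type*} [Fintype V] [DecidableEq V] (G : SimpleGraph V)
    (σ : G.edgeSet → ℤˣ) : Multiset ℝ :=
  (signedAdjMatrix G σ).charpoly.roots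

open Classical in
/-- The spectrum of `(G, σ)` is symmetric: for each eigenvalue `x`, also `-x` is an eigenvalue,
with the same multiplicity. -/
def IsSpectrallySymmetric {V : Type*} [Fintype V] [DecidableEq V] (G : SimpleGraph V)
    (σ : G.edgeSet → ℤˣ) : Prop :=
  ∀ x ∈ signedSpectrum G σ, (signedSpectrum G σ).count (-x) = (signedSpectrum G σ).count x

/-- The sign of a cycle: the product of the signs of its edges. -/
def cycleSign {V : Type*} {G : SimpleGraph V} (σ : G.edgeSet → ℤˣ) {u : V} (C : G.Walk u u) : ℤˣ :=
  (C.edges.attach.map fun f => σ ⟨f.1, C.edges_subset_edgeSet f.2⟩).prod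

/-- The number of `k`-matchings of a finite graph: sets of `k` edges, no two of which have a common
endpoint. -/
noncomputable def numMatchings {W : Type*} (H : SimpleGraph W) (k : ℕ) : ℕ :=
  Set.ncard {M : Finset (Sym2 W) | (M : Set (Sym2 W)) ⊆ H.edgeSet ∧ M.card = k ∧
    ∀ e ∈ M, ∀ f ∈ M, e ≠ f → ∀ v : W, v ∈ e → v ∉ f}

open Polynomial in
/-- The matching polynomial `∑ i, (-1)^i m_i(H) x^(n - 2i)` of a finite graph with `n` vertices.
A matching has at most `n / 2` edges, so that all nonzero terms are included. -/
noncomputable def matchingPolynomial {W : Type*} (H : SimpleGraph W) : ℤ[X] :=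
  ∑ i ∈ Finset.range (Nat.card W / 2 + 1),
    C ((-1 : ℤ) ^ i * (numMatchings H i : ℤ)) * X ^ (Nat.card W - 2 * i)

/-- The graph `G - C`, obtained by deleting the vertices of the cycle `C`. -/
def deleteCycle {V : Type*} (G : SimpleGraph V) {u : V} (C : G.Walk u u) :
    SimpleGraph {v : V | v ∉ C.support} :=
  G.induce {v : V | v ∉ C.support}

end SignedSpectra

/-! Write `s`, `t` for the signs of `C₁`, `C₂`. Switching (conjugation by a diagonal ±1 matrix)
makes the tree positive, so the characteristic polynomial depends only on `s` and `t` and has the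
form φ(s,t) = α + sβ + tγ + stδ. The matrix is real symmetric, so the spectrum is symmetric iff A
and -A have the same characteristic polynomial. Negating A multiplies the sign of a cycle by -1 to
its length. Two even cycles thus give symmetry at once; for two odd ones the condition is sβ + tγ =
0.

The coefficients come from averaging over signatures. Flipping one edge is a sign-reversing
involution, so in an average only terms even in every free sign survive. The mean of φ over all
signatures is the matching polynomial (`sum_det_delMatrix_eq_matchingPolynomialIn`). The mean of s·φ
is β; expanding the determinant along the cycle shows that it is -2 M(G - C₁)
(`sum_walkSign_mul_det`, `coeff_eq_matchingPolynomial`). Matching polynomials are monic, so sM(G -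
C₁) + tM(G - C₂) = 0 forces s = -t and equality of the two.

If C₁ is odd, C₂ even and they share no edge, symmetry would mean φ(s,t) = φ(-s,t). Averaging s·φ
over the signs on C₁ alone, which leaves t fixed, would give 0, but it is -2 times the
characteristic polynomial of G - C₁ (`det_delMatrix_pairSign_ne`).

An admissible tree exists because an odd and an even spanning cycle with a common edge can be traded
for two odd ones by a tree exchange (`exists_odd_pair_of_common_edge`). -/

namespace SignedSpectra

/-! ### Expansions of determinants and adjugates about one vertex -/

section Adjugate

variable {V R : Type*} [DecidableEq V] [CommRing R]

/-- The matrix `B` with the row and the column of `a` replaced by those of the identity. -/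
def isolate (B : Matrix V V R) (a : V) : Matrix V V R :=
  Matrix.of fun i j => if i = a ∨ j = a then (1 : Matrix V V R) i j else B i j

lemma isolate_transpose (B : Matrix V V R) (a : V) :
    isolate B.transpose a = (isolate B a).transpose := by
  ext i j
  simp [isolate, Matrix.one_apply, or_comm, eq_comm]

lemma sum_sum_eq_of_symm (s : Finset V) {v : V} (hv : v ∈ s) (f : V → V → R)
    (hf : ∀ k l, f k l = f l k) :
    ∑ k ∈ s, ∑ l ∈ s, f k l =
      2 * ∑ l ∈ s, f v l - f v v + ∑ k ∈ s.erase v, ∑ l ∈ s.erase v, f k l := by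
  have h : ∀ k, ∑ l ∈ s, f k l = f v k + ∑ l ∈ s.erase v, f k l := fun k => by
    rw [← Finset.add_sum_erase _ _ hv, hf k v]
  rw [← Finset.add_sum_erase s (fun k => ∑ l ∈ s, f k l) hv,
    Finset.sum_congr rfl fun k (_ : k ∈ s.erase v) => h k, Finset.sum_add_distrib]
  have := h v
  linear_combination -this

variable [Fintype V]

lemma adjugate_self_eq_det_isolate (B : Matrix V V R) (a : V) :
    B.adjugate a a = (isolate B a).det := by
  rw [Matrix.adjugate_apply]
  refine Matrix.det_eq_of_forall_row_eq_smul_add_const (fun i => if i = a then 0 else B i a) a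
    (by simp) fun i j => ?_
  by_cases hi : i = a <;> by_cases hj : j = a <;>
    simp_all [isolate, Matrix.updateRow_apply, Matrix.one_apply, @eq_comm _ a]

lemma det_updateRow_updateRow_single (B : Matrix V V R) {a j k : V} (hj : j ≠ a)
    (hk : k ≠ a) : ((B.updateRow a (Pi.single a 1)).updateRow j (Pi.single k 1)).det =
      (isolate B a).adjugate k j := by
  rw [Matrix.adjugate_apply]
  refine Matrix.det_eq_of_forall_row_eq_smul_add_const
    (fun i => if i = a ∨ i = j then 0 else B i a) a (by simp) fun i l => ?_
  by_cases hi : i = a <;> by_cases hl : l = a <;> by_cases hij : i = j <;>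
    simp_all [isolate, Matrix.updateRow_apply, Matrix.one_apply, eq_comm]

/-- One step of a path from `i` to `j`: expand along row `i` the determinant that defines the entry.
The minus sign is that of the swap of rows `i` and `j`. -/
lemma adjugate_eq_neg_sum_isolate (B : Matrix V V R) {i j : V} (hij : i ≠ j) :
    B.adjugate i j = -∑ k ∈ Finset.univ.erase i, B i k * (isolate B i).adjugate k j := by
  rw [Matrix.adjugate_apply, Matrix.det_eq_sum_mul_adjugate_row _ i,
    ← Finset.add_sum_erase _ _ (Finset.mem_univ i), ← Finset.sum_neg_distrib]
  have h0 : (B.updateRow j (Pi.single i 1)).adjugate i i = 0 := by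
    rw [Matrix.adjugate_apply]
    refine Matrix.det_zero_of_row_eq hij ?_
    ext l
    simp [Matrix.updateRow_apply, hij.symm]
  rw [h0, mul_zero, zero_add]
  refine Finset.sum_congr rfl fun k hk => ?_
  have hki := Finset.ne_of_mem_erase hk
  rw [Matrix.updateRow_ne hij, Matrix.adjugate_apply,
    ← det_updateRow_updateRow_single B hij.symm hki]
  have h1 : (B.updateRow j (Pi.single i 1)).updateRow i (Pi.single k 1) =
      ((B.updateRow i (Pi.single i 1)).updateRow j (Pi.single k 1)).submatrix
        (Equiv.swap i j) id := by
    ext x y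
    by_cases hx : x = i
    · subst hx; simp [Matrix.updateRow_apply]
    · by_cases hx' : x = j
      · subst hx'; simp [Matrix.updateRow_apply, hij, hij.symm]
      · simp [Matrix.updateRow_apply, hx, hx', Equiv.swap_apply_of_ne_of_ne hx hx']
  rw [h1, Matrix.det_permute, Equiv.Perm.sign_swap hij]
  simp

lemma det_eq_isolate_add_sum (B : Matrix V V R) (a : V) :
    B.det = B a a * (isolate B a).det +
      ∑ k ∈ Finset.univ.erase a, B a k * B.adjugate k a := by
  rw [Matrix.det_eq_sum_mul_adjugate_row _ a, ← Finset.add_sum_erase _ _ (Finset.mem_univ a),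
    adjugate_self_eq_det_isolate]

lemma det_eq_isolate_sub_sum (B : Matrix V V R) (a : V) :
    B.det = B a a * (isolate B a).det -
      ∑ k ∈ Finset.univ.erase a, ∑ l ∈ Finset.univ.erase a,
        B a k * B l a * (isolate B a).adjugate k l := by
  rw [det_eq_isolate_add_sum, sub_eq_add_neg, ← Finset.sum_neg_distrib]
  congr 1
  refine Finset.sum_congr rfl fun k hk => ?_
  have hka := Finset.ne_of_mem_erase hk
  rw [← Matrix.transpose_apply B.adjugate, Matrix.adjugate_transpose,
    adjugate_eq_neg_sum_isolate _ hka.symm, mul_neg, Finset.mul_sum]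
  congr 1
  refine Finset.sum_congr rfl fun l _ => ?_
  rw [isolate_transpose, ← Matrix.adjugate_transpose, Matrix.transpose_apply,
    Matrix.transpose_apply, mul_assoc]

/-- Groups the expansion about `u` by its dependence on the entry `B u v`. The adjugate `B.adjugate
v u` itself contains `B u v`, so doubling the product counts the square of that entry once too
often; the third term corrects this. -/
lemma det_eq_of_symm {B : Matrix V V R} (hB : B.transpose = B) {u v : V} (huv : u ≠ v) :
    B.det = B u u * (isolate B u).det + 2 * (B u v * B.adjugate v u) +
      B u v * B u v * (isolate B u).adjugate v v -
      ∑ k ∈ (Finset.univ.erase u).erase v, ∑ l ∈ (Finset.univ.erase u).erase v,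
        B u k * B u l * (isolate B u).adjugate k l := by
  have hadj : ∀ k l, (isolate B u).adjugate k l = (isolate B u).adjugate l k := fun k l => by
    rw [← Matrix.transpose_apply (isolate B u).adjugate, Matrix.adjugate_transpose,
      ← isolate_transpose, hB]
  have hB' : ∀ l, B l u = B u l := fun l => by
    conv_lhs => rw [← hB]
    rfl
  have h1 : B.adjugate v u = B.adjugate u v := by
    rw [← Matrix.transpose_apply B.adjugate, Matrix.adjugate_transpose, hB]
  rw [det_eq_isolate_sub_sum B u, h1, adjugate_eq_neg_sum_isolate B huv]
  simp only [hB']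
  rw [sum_sum_eq_of_symm _ (show v ∈ Finset.univ.erase u by simp [huv.symm])
    (fun k l => B u k * B u l * (isolate B u).adjugate k l)
    (fun k l => by rw [hadj k l, mul_comm (B u k)])]
  simp only [hadj _ v, mul_neg, Finset.mul_sum, mul_assoc]
  ring

end Adjugate

/-! ### Averaging over signatures along paths and cycles -/

section SignAveraging

open Polynomial SimpleGraph

variable {V : Type*}

/-- The sign of a walk, for signs given on all unordered pairs of vertices. -/
def walkSign {G : SimpleGraph V} (τ : Sym2 V → ℤˣ) {u v : V} (P : G.Walk u v) : ℤˣ :=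
  (P.edges.map τ).prod

@[simp] lemma walkSign_nil {G : SimpleGraph V} (τ : Sym2 V → ℤˣ) (u : V) :
    walkSign τ (Walk.nil : G.Walk u u) = 1 := by simp [walkSign]

@[simp] lemma walkSign_cons {G : SimpleGraph V} (τ : Sym2 V → ℤˣ) {u v w : V} (h : G.Adj u v)
    (P : G.Walk v w) : walkSign τ (Walk.cons h P) = τ s(u, v) * walkSign τ P := by
  simp [walkSign]

lemma walkSign_congr {G : SimpleGraph V} {τ τ' : Sym2 V → ℤˣ} {u v : V} (P : G.Walk u v)
    (h : ∀ e ∈ P.edges, τ e = τ' e) : walkSign τ P = walkSign τ' P := by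
  rw [walkSign, walkSign, List.map_congr_left h]

lemma unit_cast_mul_self {R : Type*} [Ring R] (u : ℤˣ) :
    (((u : ℤ) : R)) * ((u : ℤ) : R) = 1 := by
  rcases Int.units_eq_one_or u with rfl | rfl <;> simp

lemma walkSign_mul {G : SimpleGraph V} (τ τ' : Sym2 V → ℤˣ) {u v : V} (P : G.Walk u v) :
    walkSign (fun e => τ e * τ' e) P = walkSign τ P * walkSign τ' P := by
  simp [walkSign, List.prod_map_mul]

lemma sym2_ne_of_right_ne {i k l : V} (h : k ≠ l) : s(i, k) ≠ s(i, l) := fun he =>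
  h (Sym2.congr_right.1 he)

variable [DecidableEq V]

lemma walkSign_eq_of_nodup {G : SimpleGraph V} (τ : Sym2 V → ℤˣ) {u v : V} {P : G.Walk u v}
    (hP : P.edges.Nodup) {e : Sym2 V} (he : e ∈ P.edges) (h : ∀ f ∈ P.edges, f ≠ e → τ f = 1) :
    walkSign τ P = τ e := by
  rw [walkSign, ← List.prod_toFinset _ hP]
  refine Finset.prod_eq_single_of_mem _ (List.mem_toFinset.2 he) fun f hf hfe => ?_
  exact h f (List.mem_toFinset.1 hf) hfe

/-- Changes the sign of the pair `e`. -/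
def flipSign (e : Sym2 V) (τ : Sym2 V → ℤˣ) : Sym2 V → ℤˣ := Function.update τ e (-τ e)

@[simp] lemma flipSign_self (e : Sym2 V) (τ : Sym2 V → ℤˣ) : flipSign e τ e = -τ e := by
  simp [flipSign]

lemma flipSign_of_ne {e f : Sym2 V} (τ : Sym2 V → ℤˣ) (h : f ≠ e) : flipSign e τ f = τ f := by
  simp [flipSign, h]

lemma flipSign_flipSign (e : Sym2 V) (τ : Sym2 V → ℤˣ) : flipSign e (flipSign e τ) = τ := by
  funext f
  by_cases h : f = e <;> simp [flipSign, h]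

lemma walkSign_flipSign_of_notMem {G : SimpleGraph V} (τ : Sym2 V → ℤˣ) {u v : V}
    {P : G.Walk u v} {e : Sym2 V} (he : e ∉ P.edges) :
    walkSign (flipSign e τ) P = walkSign τ P :=
  walkSign_congr P fun _ hf => flipSign_of_ne τ fun h => he (h ▸ hf)

lemma walkSign_flipSign_of_mem {G : SimpleGraph V} (τ : Sym2 V → ℤˣ) {u v : V}
    {P : G.Walk u v} (hP : P.edges.Nodup) {e : Sym2 V} (he : e ∈ P.edges) :
    walkSign (flipSign e τ) P = -walkSign τ P := by
  have h : flipSign e τ = fun f => (flipSign e (fun _ => 1)) f * τ f := by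
    ext f
    by_cases hf : f = e <;> simp [flipSign, hf]
  rw [h, walkSign_mul, walkSign_eq_of_nodup _ hP he fun _ _ hf => flipSign_of_ne _ hf]
  simp

lemma sum_eq_zero_of_flipSign {R : Type*} [AddCommGroup R] (𝒯 : Finset (Sym2 V → ℤˣ))
    (e : Sym2 V) (h𝒯 : ∀ τ ∈ 𝒯, flipSign e τ ∈ 𝒯) (f : (Sym2 V → ℤˣ) → R)
    (hf : ∀ τ ∈ 𝒯, f (flipSign e τ) = -f τ) : ∑ τ ∈ 𝒯, f τ = 0 := by
  refine Finset.sum_involution (fun τ _ => flipSign e τ) (fun τ h => by rw [hf τ h, add_neg_cancel])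
    (fun τ _ _ h => ?_) h𝒯 fun τ _ => flipSign_flipSign e τ
  have := congrFun h e
  rw [flipSign_self] at this
  rcases Int.units_eq_one_or (τ e) with h1 | h1 <;> rw [h1] at this <;> revert this <;> decide

open Classical in
/-- The characteristic matrix of the graph `G` with signs `τ`, in which the rows and columns of the
vertices in `S` are replaced by those of the identity. -/
noncomputable def delMatrix (G : SimpleGraph V) (S : Set V) (τ : Sym2 V → ℤˣ) :
    Matrix V V ℝ[X] :=
  Matrix.of fun i j => if i = j then (if i ∈ S then 1 else X)
    else if G.Adj i j ∧ i ∉ S ∧ j ∉ S then -((τ s(i, j) : ℤ) : ℝ[X]) else 0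

variable {G : SimpleGraph V}

lemma delMatrix_congr {S : Set V} {τ τ' : Sym2 V → ℤˣ}
    (h : ∀ i j, G.Adj i j → i ∉ S → j ∉ S → τ s(i, j) = τ' s(i, j)) :
    delMatrix G S τ = delMatrix G S τ' := by
  ext1 i j
  simp only [delMatrix, Matrix.of_apply]
  split_ifs with h1 h2 h3
  · rfl
  · rfl
  · rw [h i j h3.1 h3.2.1 h3.2.2]
  · rfl

lemma delMatrix_apply_congr {S : Set V} {τ τ' : Sym2 V → ℤˣ} {i j : V}
    (h : τ s(i, j) = τ' s(i, j)) : delMatrix G S τ i j = delMatrix G S τ' i j := by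
  simp only [delMatrix, Matrix.of_apply, h]

lemma delMatrix_flipSign {S : Set V} (τ : Sym2 V → ℤˣ) {i j : V} (h : i ∈ S ∨ j ∈ S) :
    delMatrix G S (flipSign s(i, j) τ) = delMatrix G S τ := by
  refine delMatrix_congr fun k l _ hk hl => flipSign_of_ne _ fun he => ?_
  rcases Sym2.eq_iff.1 he with ⟨rfl, rfl⟩ | ⟨rfl, rfl⟩ <;> tauto

lemma delMatrix_transpose (S : Set V) (τ : Sym2 V → ℤˣ) :
    (delMatrix G S τ).transpose = delMatrix G S τ := by
  classical
  ext1 i j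
  rw [Matrix.transpose_apply]
  by_cases h : i = j
  · rw [h]
  · simp only [delMatrix, Matrix.of_apply, h, Ne.symm h, if_false, Sym2.eq_swap (a := j)]
    exact if_congr (by rw [G.adj_comm, and_comm (a := j ∉ S)]) rfl rfl

lemma isolate_delMatrix (S : Set V) (τ : Sym2 V → ℤˣ) (a : V) :
    isolate (delMatrix G S τ) a = delMatrix G (insert a S) τ := by
  classical
  ext1 i j
  simp only [isolate, delMatrix, Matrix.of_apply, Matrix.one_apply]
  by_cases h : i = j
  · subst h
    by_cases hi : i = a
    · simp [hi]
    · simp only [hi, or_self, if_false, if_true]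
      split_ifs <;> simp_all
  · by_cases hi : i = a
    · subst hi; simp [h]
    · by_cases hj : j = a
      · subst hj; simp [h]
      · simp only [h, hi, hj, or_self, if_false]
        split_ifs <;> simp_all

lemma delMatrix_apply_self {S : Set V} (τ : Sym2 V → ℤˣ) {i : V} (h : i ∉ S) :
    delMatrix G S τ i i = X := by
  simp [delMatrix, h]

lemma delMatrix_apply_adj {S : Set V} (τ : Sym2 V → ℤˣ) {i j : V} (h : G.Adj i j) (hi : i ∉ S)
    (hj : j ∉ S) : delMatrix G S τ i j = -((τ s(i, j) : ℤ) : ℝ[X]) := by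
  simp [delMatrix, h, hi, hj, h.ne]

lemma delMatrix_apply_flipSign {S : Set V} (τ : Sym2 V → ℤˣ) {i j : V} (h : i ≠ j) :
    delMatrix G S (flipSign s(i, j) τ) i j = -delMatrix G S τ i j := by
  simp only [delMatrix, Matrix.of_apply, h, if_false, flipSign_self]
  split_ifs <;> simp

variable [Fintype V]

/-- Averaging the path sign times the corresponding entry of the adjugate over a set of signs that
is closed under changes on the path gives the average determinant of the rest. -/
lemma sum_walkSign_mul_adjugate {𝒯 : Finset (Sym2 V → ℤˣ)} {i j : V} (P : G.Walk i j)
    (hP : P.IsPath) (S : Set V) (hS : ∀ y ∈ P.support, y ∉ S)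
    (h𝒯 : ∀ e ∈ P.edges, ∀ τ ∈ 𝒯, flipSign e τ ∈ 𝒯) :
    ∑ τ ∈ 𝒯, ((walkSign τ P : ℤ) : ℝ[X]) * (delMatrix G S τ).adjugate i j =
      ∑ τ ∈ 𝒯, (delMatrix G (S ∪ {y | y ∈ P.support}) τ).det := by
  induction P generalizing S with
  | nil =>
    refine Finset.sum_congr rfl fun τ _ => ?_
    rw [adjugate_self_eq_det_isolate, isolate_delMatrix]
    simp
  | @cons i k j h Q ih =>
    rw [Walk.cons_isPath_iff] at hP
    have hij : i ≠ j := fun hij => hP.2 (hij ▸ Q.end_mem_support)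
    have hi : i ∉ S := hS i (by simp)
    have hk : k ∉ S := hS k (by simp)
    have hset : S ∪ {y | y ∈ (Walk.cons h Q).support} = insert i S ∪ {y | y ∈ Q.support} := by
      ext y
      simp only [Walk.support_cons, Set.mem_union, Set.mem_ofPred_eq, List.mem_cons,
        Set.mem_insert_iff]
      tauto
    rw [hset, ← ih hP.1 (insert i S) (fun y hy => by
      rintro (rfl | hyS)
      · exact hP.2 hy
      · exact hS y (by simp [hy]) hyS) fun e he => h𝒯 e (by simp [he])]
    have hexp : ∀ τ, ((walkSign τ (Walk.cons h Q) : ℤ) : ℝ[X]) * (delMatrix G S τ).adjugate i j =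
        ∑ l ∈ Finset.univ.erase i, -(((walkSign τ (Walk.cons h Q) : ℤ) : ℝ[X]) *
          (delMatrix G S τ i l * (delMatrix G (insert i S) τ).adjugate l j)) := fun τ => by
      rw [adjugate_eq_neg_sum_isolate _ hij, isolate_delMatrix, mul_neg, Finset.mul_sum,
        Finset.sum_neg_distrib]
    simp only [hexp]
    rw [Finset.sum_comm, Finset.sum_eq_single_of_mem k (by simp [h.ne'])]
    · refine Finset.sum_congr rfl fun τ _ => ?_
      rw [delMatrix_apply_adj τ h hi hk, walkSign_cons]
      push_cast
      linear_combination ((walkSign τ Q : ℤ) : ℝ[X]) * (delMatrix G (insert i S) τ).adjugate k j *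
        unit_cast_mul_self (R := ℝ[X]) (τ s(i, k))
    -- Only the walk sign sees the edge `s(i, k)`: the entry at `(i, l)` is another pair and the
    -- remaining matrix has lost `i`. The term is odd in that sign and cancels.
    · intro l _ hlk
      refine sum_eq_zero_of_flipSign 𝒯 s(i, k) (h𝒯 _ (by simp)) _ fun τ _ => ?_
      rw [delMatrix_flipSign τ (Or.inl (Set.mem_insert i S)), delMatrix_apply_congr
        (flipSign_of_ne τ (sym2_ne_of_right_ne hlk)), walkSign_cons, walkSign_cons,
        walkSign_flipSign_of_notMem τ fun he => hP.2 (Walk.fst_mem_support_of_mem_edges Q he)]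
      simp

/-- Averaging the sign of a cycle times the characteristic polynomial over a set of signs that is
closed under changes on the cycle gives `-2` times the average characteristic polynomial of the
rest. -/
lemma sum_walkSign_mul_det {𝒯 : Finset (Sym2 V → ℤˣ)} {u : V} (C : G.Walk u u) (hC : C.IsCycle)
    (h𝒯 : ∀ e ∈ C.edges, ∀ τ ∈ 𝒯, flipSign e τ ∈ 𝒯) :
    ∑ τ ∈ 𝒯, ((walkSign τ C : ℤ) : ℝ[X]) * (delMatrix G ∅ τ).det =
      -2 * ∑ τ ∈ 𝒯, (delMatrix G {y | y ∈ C.support} τ).det := by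
  cases C with
  | nil => exact absurd rfl hC.ne_nil
  | @cons u v _ h P =>
    rw [Walk.cons_isCycle_iff] at hC
    obtain ⟨hP, he⟩ := hC
    have hset : {y | y ∈ (Walk.cons h P).support} = ∅ ∪ {y | y ∈ P.support} := by
      ext y
      simp only [Walk.support_cons, Set.mem_union, Set.mem_ofPred_eq, List.mem_cons,
        Set.mem_empty_iff_false, false_or, or_iff_right_iff_imp]
      rintro rfl
      exact P.end_mem_support
    rw [hset, ← sum_walkSign_mul_adjugate P hP ∅ (by simp) fun e he => h𝒯 e (by simp [he]),
      Finset.mul_sum]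
    set D := fun τ => delMatrix G {u} τ with hD
    set B := fun τ => delMatrix G ∅ τ with hB
    have hiso : ∀ τ, isolate (B τ) u = D τ := fun τ => by simp [hB, hD, isolate_delMatrix]
    set s := fun τ => ((walkSign τ (Walk.cons h P) : ℤ) : ℝ[X]) with hs
    have hsflip : ∀ τ, s (flipSign s(u, v) τ) = -s τ := fun τ => by
      simp [hs, walkSign_flipSign_of_notMem τ he]
    have hDflip : ∀ τ, D (flipSign s(u, v) τ) = D τ := fun τ =>
      delMatrix_flipSign τ (Or.inl rfl)
    have hzero : ∀ f : (Sym2 V → ℤˣ) → ℝ[X], (∀ τ, f (flipSign s(u, v) τ) = f τ) →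
        ∑ τ ∈ 𝒯, s τ * f τ = 0 := fun f hf =>
      sum_eq_zero_of_flipSign 𝒯 s(u, v) (h𝒯 _ (by simp)) _ fun τ _ => by
        rw [hsflip, hf, neg_mul]
    have hBne : ∀ τ k, k ≠ v → B (flipSign s(u, v) τ) u k = B τ u k := fun τ k hk =>
      delMatrix_apply_congr (flipSign_of_ne τ (sym2_ne_of_right_ne hk))
    have hBuv : ∀ τ, B (flipSign s(u, v) τ) u v = -B τ u v := fun τ =>
      delMatrix_apply_flipSign τ h.ne
    -- Apart from the term with `(B τ).adjugate v u`, everything multiplied by `s τ` is invariant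
    -- under flipping `s(u, v)`, while `s τ` changes sign; so only that term survives, and it is the
    -- path sum for `P`.
    have hexp : ∀ τ, s τ * (B τ).det = s τ * (B τ u u * (D τ).det)
        + s τ * (2 * (B τ u v * (B τ).adjugate v u))
        + s τ * (B τ u v * B τ u v * (D τ).adjugate v v)
        - s τ * ∑ k ∈ (Finset.univ.erase u).erase v, ∑ l ∈ (Finset.univ.erase u).erase v,
          B τ u k * B τ u l * (D τ).adjugate k l := fun τ => by
      rw [det_eq_of_symm (delMatrix_transpose ∅ τ) h.ne, hiso]
      ring
    have h1 := hzero (fun τ => B τ u u * (D τ).det) fun τ => by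
      simp only [hDflip, hBne τ u h.ne]
    have h2 := hzero (fun τ => B τ u v * B τ u v * (D τ).adjugate v v) fun τ => by
      simp only [hDflip, hBuv]; ring
    have h3 := hzero (fun τ => ∑ k ∈ (Finset.univ.erase u).erase v,
        ∑ l ∈ (Finset.univ.erase u).erase v, B τ u k * B τ u l * (D τ).adjugate k l) fun τ => by
      refine Finset.sum_congr rfl fun k hk => Finset.sum_congr rfl fun l hl => ?_
      simp only [hDflip, hBne τ k (Finset.ne_of_mem_erase hk),
        hBne τ l (Finset.ne_of_mem_erase hl)]
    rw [Finset.sum_congr rfl fun τ _ => hexp τ, Finset.sum_sub_distrib, Finset.sum_add_distrib,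
      Finset.sum_add_distrib, h1, h2, h3, zero_add, add_zero, sub_zero]
    refine Finset.sum_congr rfl fun τ _ => ?_
    have h4 : B τ u v = -((τ s(u, v) : ℤ) : ℝ[X]) :=
      delMatrix_apply_adj τ h (by simp) (by simp)
    rw [h4]
    simp only [hs, walkSign_cons]
    push_cast
    linear_combination -2 * ((walkSign τ P : ℤ) : ℝ[X]) * (B τ).adjugate v u *
      unit_cast_mul_self (R := ℝ[X]) (τ s(u, v))

end SignAveraging

/-! ### The matching polynomial as the mean characteristic polynomial -/

section MatchingPolynomial

open Polynomial SimpleGraph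

variable {V : Type*} [DecidableEq V]

lemma setOf_notMem_erase (A : Finset V) (v : V) :
    {x | x ∉ A.erase v} = insert v {x | x ∉ A} := by
  ext x
  simp only [Set.mem_ofPred_eq, Finset.mem_erase, Set.mem_insert_iff]
  tauto

variable [Fintype V]

open Classical in
/-- The matchings of `G` all of whose vertices are in `A`. -/
noncomputable def matchingsIn (G : SimpleGraph V) (A : Finset V) : Finset (Finset (Sym2 V)) :=
  Finset.univ.filter fun M => (∀ e ∈ M, e ∈ G.edgeSet ∧ ∀ x ∈ e, x ∈ A) ∧
    ∀ e ∈ M, ∀ f ∈ M, e ≠ f → ∀ v : V, v ∈ e → v ∉ f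

open Classical in
/-- The vertices of `A` not covered by `M`. -/
noncomputable def uncovered (A : Finset V) (M : Finset (Sym2 V)) : Finset V :=
  A.filter fun x => ∀ e ∈ M, x ∉ e

/-- The matching polynomial of the subgraph induced by `A`. -/
noncomputable def matchingPolynomialIn (G : SimpleGraph V) (A : Finset V) : ℝ[X] :=
  ∑ M ∈ matchingsIn G A, (-1) ^ M.card * X ^ (uncovered A M).card

variable {G : SimpleGraph V} {A : Finset V} {M : Finset (Sym2 V)} {v k : V}

lemma mem_matchingsIn : M ∈ matchingsIn G A ↔
    (∀ e ∈ M, e ∈ G.edgeSet ∧ ∀ x ∈ e, x ∈ A) ∧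
      ∀ e ∈ M, ∀ f ∈ M, e ≠ f → ∀ v : V, v ∈ e → v ∉ f := by
  simp [matchingsIn]

lemma mem_uncovered {x : V} : x ∈ uncovered A M ↔ x ∈ A ∧ ∀ e ∈ M, x ∉ e := by
  simp [uncovered]

lemma matchingsIn_erase :
    M ∈ matchingsIn G (A.erase v) ↔ M ∈ matchingsIn G A ∧ ∀ e ∈ M, v ∉ e := by
  simp only [mem_matchingsIn, Finset.mem_erase]
  constructor
  · rintro ⟨h1, h2⟩
    exact ⟨⟨fun e he => ⟨(h1 e he).1, fun x hx => ((h1 e he).2 x hx).2⟩, h2⟩,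
      fun e he hv => ((h1 e he).2 v hv).1 rfl⟩
  · rintro ⟨⟨h1, h2⟩, h3⟩
    exact ⟨fun e he => ⟨(h1 e he).1, fun x hx =>
      ⟨fun h => h3 e he (h ▸ hx), (h1 e he).2 x hx⟩⟩, h2⟩

lemma card_uncovered_of_forall_notMem (hv : v ∈ A) (h : ∀ e ∈ M, v ∉ e) :
    (uncovered A M).card = (uncovered (A.erase v) M).card + 1 := by
  have : uncovered A M = insert v (uncovered (A.erase v) M) := by
    ext x
    simp only [Finset.mem_insert, mem_uncovered, Finset.mem_erase]
    by_cases hx : x = v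
    · subst hx; simp [hv]; exact h
    · simp [hx]
  rw [this, Finset.card_insert_of_notMem (by simp [mem_uncovered])]

lemma eq_of_mem_of_mem_matchingsIn (hM : M ∈ matchingsIn G A) {e f : Sym2 V} (he : e ∈ M)
    (hf : f ∈ M) (hve : v ∈ e) (hvf : v ∈ f) : e = f := by
  by_contra hef
  exact (mem_matchingsIn.1 hM).2 e he f hf hef v hve hvf

lemma uncovered_insert : uncovered A (insert s(v, k) M) = uncovered ((A.erase v).erase k) M := by
  ext x
  simp only [mem_uncovered, Finset.mem_insert, Finset.mem_erase, forall_eq_or_imp, Sym2.mem_iff]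
  tauto

lemma insert_mem_matchingsIn (h : G.Adj v k) (hv : v ∈ A) (hk : k ∈ A)
    (hM : M ∈ matchingsIn G ((A.erase v).erase k)) : insert s(v, k) M ∈ matchingsIn G A := by
  obtain ⟨h1, hk'⟩ := matchingsIn_erase.1 hM
  obtain ⟨h2, hv'⟩ := matchingsIn_erase.1 h1
  obtain ⟨h3, h4⟩ := mem_matchingsIn.1 h2
  have hd : ∀ f ∈ M, ∀ x, x ∈ s(v, k) → x ∉ f := by
    intro f hf x hx
    rcases Sym2.mem_iff.1 hx with rfl | rfl
    exacts [hv' f hf, hk' f hf]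
  rw [mem_matchingsIn]
  refine ⟨fun e he => ?_, fun e he f hf hef x hxe hxf => ?_⟩
  · rcases Finset.mem_insert.1 he with rfl | he
    · refine ⟨h, fun x hx => ?_⟩
      rcases Sym2.mem_iff.1 hx with rfl | rfl <;> assumption
    · exact h3 e he
  · rcases Finset.mem_insert.1 he with rfl | he <;> rcases Finset.mem_insert.1 hf with rfl | hf
    · exact hef rfl
    · exact hd f hf x hxe hxf
    · exact hd e he x hxf hxe
    · exact h4 e he f hf hef x hxe hxf

lemma erase_mem_matchingsIn (hM : M ∈ matchingsIn G A) (h : s(v, k) ∈ M) :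
    M.erase s(v, k) ∈ matchingsIn G ((A.erase v).erase k) := by
  have h1 : M.erase s(v, k) ∈ matchingsIn G A := by
    rw [mem_matchingsIn] at hM ⊢
    exact ⟨fun e he => hM.1 e (Finset.mem_of_mem_erase he), fun e he f hf =>
      hM.2 e (Finset.mem_of_mem_erase he) f (Finset.mem_of_mem_erase hf)⟩
  refine matchingsIn_erase.2 ⟨matchingsIn_erase.2 ⟨h1, fun e he hv => ?_⟩, fun e he hv => ?_⟩
  · exact Finset.ne_of_mem_erase he
      (eq_of_mem_of_mem_matchingsIn hM (Finset.mem_of_mem_erase he) h hv (by simp))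
  · exact Finset.ne_of_mem_erase he
      (eq_of_mem_of_mem_matchingsIn hM (Finset.mem_of_mem_erase he) h hv (by simp))

open Classical in
lemma sum_matchingsIn_containing (h : G.Adj v k) (hv : v ∈ A) (hk : k ∈ A) :
    ∑ M ∈ matchingsIn G A with s(v, k) ∈ M, (-1 : ℝ[X]) ^ M.card * X ^ (uncovered A M).card =
      -matchingPolynomialIn G ((A.erase v).erase k) := by
  rw [matchingPolynomialIn, ← Finset.sum_neg_distrib]
  symm
  have hnot : ∀ M ∈ matchingsIn G ((A.erase v).erase k), s(v, k) ∉ M := fun M hM hmem =>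
    (matchingsIn_erase.1 hM).2 _ hmem (by simp)
  refine Finset.sum_bij' (fun M _ => insert s(v, k) M) (fun M _ => M.erase s(v, k)) ?_ ?_ ?_ ?_ ?_
  · exact fun M hM => Finset.mem_filter.2 ⟨insert_mem_matchingsIn h hv hk hM, by simp⟩
  · exact fun M hM => erase_mem_matchingsIn (Finset.mem_filter.1 hM).1 (Finset.mem_filter.1 hM).2
  · exact fun M hM => Finset.erase_insert (hnot M hM)
  · exact fun M hM => Finset.insert_erase (Finset.mem_filter.1 hM).2
  · intro M hM
    rw [Finset.card_insert_of_notMem (hnot M hM), uncovered_insert, pow_succ]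
    ring

open Classical in
-- A matching either misses `v` or covers it by exactly one edge `s(v, k)`.
lemma matchingPolynomialIn_eq (hv : v ∈ A) :
    matchingPolynomialIn G A = X * matchingPolynomialIn G (A.erase v) -
      ∑ k ∈ Finset.univ.erase v, if G.Adj v k ∧ k ∈ A then
        matchingPolynomialIn G ((A.erase v).erase k) else 0 := by
  have hsplit : ∀ M ∈ matchingsIn G A, (-1 : ℝ[X]) ^ M.card * X ^ (uncovered A M).card =
      (if ∀ e ∈ M, v ∉ e then (-1 : ℝ[X]) ^ M.card * X ^ (uncovered A M).card else 0) +
      ∑ k ∈ Finset.univ.erase v, if s(v, k) ∈ M then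
        (-1 : ℝ[X]) ^ M.card * X ^ (uncovered A M).card else 0 := by
    intro M hM
    by_cases h : ∀ e ∈ M, v ∉ e
    · rw [if_pos h, Finset.sum_eq_zero, add_zero]
      exact fun k _ => if_neg fun hk => h _ hk (by simp)
    · rw [if_neg h, zero_add]
      push Not at h
      obtain ⟨e, he, hve⟩ := h
      obtain ⟨k, rfl⟩ := hve
      have hvk : G.Adj v k := ((mem_matchingsIn.1 hM).1 _ he).1
      rw [Finset.sum_eq_single_of_mem k (by simp [hvk.ne']), if_pos he]
      intro l _ hl
      refine if_neg fun hl' => hl ?_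
      exact Sym2.congr_right.1 (eq_of_mem_of_mem_matchingsIn (v := v) hM hl' he (by simp) (by simp))
  rw [matchingPolynomialIn, Finset.sum_congr rfl hsplit, Finset.sum_add_distrib, Finset.sum_comm,
    sub_eq_add_neg, ← Finset.sum_neg_distrib]
  congr 1
  · rw [← Finset.sum_filter, matchingPolynomialIn, Finset.mul_sum]
    have : (matchingsIn G A).filter (fun M => ∀ e ∈ M, v ∉ e) = matchingsIn G (A.erase v) := by
      ext M
      rw [Finset.mem_filter, matchingsIn_erase]
    rw [this]
    refine Finset.sum_congr rfl fun M hM => ?_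
    rw [card_uncovered_of_forall_notMem hv (matchingsIn_erase.1 hM).2, pow_succ]
    ring
  · refine Finset.sum_congr rfl fun k _ => ?_
    rw [← Finset.sum_filter]
    split_ifs with h
    · exact sum_matchingsIn_containing h.1 hv h.2
    · rw [neg_zero]
      refine Finset.sum_eq_zero fun M hM => (h ?_).elim
      obtain ⟨hM, hk⟩ := Finset.mem_filter.1 hM
      have := (mem_matchingsIn.1 hM).1 _ hk
      exact ⟨this.1, this.2 k (by simp)⟩

lemma matchingPolynomialIn_empty : matchingPolynomialIn G ∅ = 1 := by
  have : matchingsIn G ∅ = {∅} := by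
    ext M
    rw [mem_matchingsIn, Finset.mem_singleton]
    constructor
    · rintro ⟨h, -⟩
      refine Finset.eq_empty_of_forall_notMem fun e he => ?_
      induction e with | _ x y =>
      simpa using (h _ he).2 x (by simp)
    · rintro rfl
      simp
  simp [matchingPolynomialIn, this, uncovered]

open Classical in
-- The recurrence of the matching polynomial. In the double sum of the expansion about `v`, a term
-- with `k ≠ l` is odd in the sign of `s(v, k)` and averages out; for `k = l` that sign is squared.
lemma sum_det_delMatrix_eq (hv : v ∈ A) :
    ∑ τ, (delMatrix G {x | x ∉ A} τ).det =
      X * ∑ τ, (delMatrix G {x | x ∉ A.erase v} τ).det -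
      ∑ k ∈ Finset.univ.erase v, if G.Adj v k ∧ k ∈ A then
        ∑ τ, (delMatrix G {x | x ∉ (A.erase v).erase k} τ).det else 0 := by
  set B := fun τ => delMatrix G {x | x ∉ A} τ with hB
  set D := fun τ => delMatrix G {x | x ∉ A.erase v} τ with hD
  have hiso : ∀ τ, isolate (B τ) v = D τ := fun τ => by
    simp only [hB, hD, isolate_delMatrix, setOf_notMem_erase]
  have hBsymm : ∀ τ l, B τ l v = B τ v l := fun τ l =>
    congrFun (congrFun (delMatrix_transpose (G := G) {x | x ∉ A} τ) v) l
  have h1 : ∀ τ, (B τ).det = X * (D τ).det -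
      ∑ k ∈ Finset.univ.erase v, ∑ l ∈ Finset.univ.erase v,
        B τ v k * B τ v l * (D τ).adjugate k l := fun τ => by
    have hvv : B τ v v = X := delMatrix_apply_self τ (by simpa using hv)
    rw [det_eq_isolate_sub_sum _ v, hiso, hvv]
    simp only [hBsymm]
  rw [Finset.sum_congr rfl fun τ _ => h1 τ, Finset.sum_sub_distrib, ← Finset.mul_sum,
    Finset.sum_comm]
  congr 1
  refine Finset.sum_congr rfl fun k hk => ?_
  have hkv := Finset.ne_of_mem_erase hk
  rw [Finset.sum_comm, Finset.sum_eq_single_of_mem k hk]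
  · split_ifs with h
    · refine Finset.sum_congr rfl fun τ _ => ?_
      have h2 : B τ v k = -((τ s(v, k) : ℤ) : ℝ[X]) :=
        delMatrix_apply_adj τ h.1 (by simpa using hv) (by simpa using h.2)
      rw [h2, neg_mul_neg, unit_cast_mul_self, one_mul, adjugate_self_eq_det_isolate,
        isolate_delMatrix, setOf_notMem_erase _ k]
    · refine Finset.sum_eq_zero fun τ _ => ?_
      have h2 : B τ v k = 0 := by
        simp only [hB, delMatrix, Matrix.of_apply, hkv.symm, if_false]
        refine if_neg fun h' => h ⟨h'.1, ?_⟩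
        simpa using h'.2.2
      rw [h2]
      ring
  · intro l _ hlk
    refine sum_eq_zero_of_flipSign _ s(v, k) (fun _ _ => Finset.mem_univ _) _ fun τ _ => ?_
    have h2 : D (flipSign s(v, k) τ) = D τ := delMatrix_flipSign τ (by simp)
    have h3 : B (flipSign s(v, k) τ) v k = -B τ v k := delMatrix_apply_flipSign τ hkv.symm
    have h4 : B (flipSign s(v, k) τ) v l = B τ v l :=
      delMatrix_apply_congr (flipSign_of_ne τ (sym2_ne_of_right_ne hlk))
    rw [h2, h3, h4]
    ring

/-- The average of the characteristic polynomials over all signs is the matching polynomial. -/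
lemma sum_det_delMatrix_eq_matchingPolynomialIn (G : SimpleGraph V) (A : Finset V) :
    ∑ τ, (delMatrix G {x | x ∉ A} τ).det =
      (Fintype.card (Sym2 V → ℤˣ) : ℝ[X]) * matchingPolynomialIn G A := by
  classical
  induction A using Finset.strongInduction with
  | H A ih =>
    rcases A.eq_empty_or_nonempty with rfl | ⟨v, hv⟩
    · rw [matchingPolynomialIn_empty]
      have : ∀ τ, delMatrix G {x | x ∉ (∅ : Finset V)} τ = 1 := fun τ => by
        ext1 i j
        simp [delMatrix, Matrix.one_apply]
      rw [Finset.sum_congr rfl fun τ _ => congrArg Matrix.det (this τ)]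
      simp
    · have h1 := Finset.erase_ssubset hv
      rw [sum_det_delMatrix_eq hv, matchingPolynomialIn_eq hv, ih _ h1, mul_sub, Finset.mul_sum]
      congr 1
      · ring
      · refine Finset.sum_congr rfl fun k _ => ?_
        split_ifs
        · exact ih _ ((Finset.erase_subset _ _).trans_ssubset h1)
        · simp

lemma two_mul_card_add_card_uncovered (hM : M ∈ matchingsIn G A) :
    2 * M.card + (uncovered A M).card = A.card := by
  have hA : A = M.biUnion Sym2.toFinset ∪ uncovered A M := by
    ext x
    simp only [Finset.mem_union, Finset.mem_biUnion, Sym2.mem_toFinset, mem_uncovered]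
    constructor
    · intro hx
      by_cases h : ∃ e ∈ M, x ∈ e
      · exact Or.inl h
      · exact Or.inr ⟨hx, fun e he hxe => h ⟨e, he, hxe⟩⟩
    · rintro (⟨e, he, hx⟩ | h)
      · exact ((mem_matchingsIn.1 hM).1 e he).2 x hx
      · exact h.1
  conv_rhs => rw [hA]
  rw [Finset.card_union_of_disjoint, Finset.card_biUnion,
    Finset.sum_congr rfl fun e he => Sym2.card_toFinset_of_not_isDiag e
      (G.not_isDiag_of_mem_edgeSet ((mem_matchingsIn.1 hM).1 e he).1)]
  · simp [mul_comm]
  · intro e he f hf hef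
    refine Finset.disjoint_left.2 fun x hx hx' => ?_
    exact (mem_matchingsIn.1 hM).2 e he f hf hef x (Sym2.mem_toFinset.1 hx) (Sym2.mem_toFinset.1 hx')
  · refine Finset.disjoint_left.2 fun x hx hx' => ?_
    obtain ⟨e, he, hx⟩ := Finset.mem_biUnion.1 hx
    exact (mem_uncovered.1 hx').2 e he (Sym2.mem_toFinset.1 hx)

lemma numMatchings_induce (G : SimpleGraph V) {A : Finset V} {W : Set V} (hW : ∀ x, x ∈ W ↔ x ∈ A)
    (i : ℕ) : numMatchings (G.induce W) i = ((matchingsIn G A).filter fun M => M.card = i).card := by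
  have hinj : Function.Injective (Sym2.map (Subtype.val : W → V)) :=
    Sym2.map.injective Subtype.val_injective
  rw [numMatchings, ← Set.ncard_image_of_injective _ (Finset.map_injective ⟨_, hinj⟩),
    ← Set.ncard_coe_finset]
  congr 1
  ext M
  simp only [Set.mem_image, Finset.coe_filter, Set.mem_ofPred_eq, mem_matchingsIn]
  constructor
  · rintro ⟨M, ⟨h1, h2, h3⟩, rfl⟩
    refine ⟨⟨?_, ?_⟩, by simpa using h2⟩
    · intro e he
      obtain ⟨e, he', rfl⟩ := Finset.mem_map.1 he
      have := h1 he'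
      induction e with | _ x y =>
      simp only [mem_edgeSet, comap_adj, Function.Embedding.subtype_apply] at this
      refine ⟨this, fun z hz => ?_⟩
      rcases Sym2.mem_iff.1 hz with rfl | rfl
      exacts [(hW _).1 x.2, (hW _).1 y.2]
    · intro e he f hf hef x hxe hxf
      obtain ⟨e, he', rfl⟩ := Finset.mem_map.1 he
      obtain ⟨f, hf', rfl⟩ := Finset.mem_map.1 hf
      obtain ⟨y, hy, rfl⟩ := Sym2.mem_map.1 hxe
      obtain ⟨z, hz, hzy⟩ := Sym2.mem_map.1 hxf
      obtain rfl := Subtype.val_injective hzy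
      exact h3 e he' f hf' (fun h => hef (h ▸ rfl)) z hy hz
  · rintro ⟨⟨h1, h2⟩, h3⟩
    have hM : (M.preimage _ hinj.injOn).map ⟨_, hinj⟩ = M := by
      classical
      rw [Finset.map_eq_image, Function.Embedding.coeFn_mk, Finset.image_preimage]
      refine Finset.filter_true_of_mem fun e he => ?_
      have := (h1 e he).2
      induction e with | _ x y =>
      exact ⟨s(⟨x, (hW x).2 (this x (by simp))⟩, ⟨y, (hW y).2 (this y (by simp))⟩), rfl⟩
    refine ⟨_, ⟨?_, ?_, ?_⟩, hM⟩
    · intro e he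
      have := (h1 _ (Finset.mem_preimage.1 he)).1
      induction e with | _ x y =>
      simpa using this
    · rw [← h3, ← congrArg Finset.card hM, Finset.card_map]
    · intro e he f hf hef x hxe hxf
      exact h2 _ (Finset.mem_preimage.1 he) _ (Finset.mem_preimage.1 hf) (hinj.ne hef) x
        (Sym2.mem_map.2 ⟨x, hxe, rfl⟩) (Sym2.mem_map.2 ⟨x, hxf, rfl⟩)

lemma map_matchingPolynomial_induce (G : SimpleGraph V) {A : Finset V} {W : Set V}
    (hW : ∀ x, x ∈ W ↔ x ∈ A) :
    (matchingPolynomial (G.induce W)).map (Int.castRingHom ℝ) = matchingPolynomialIn G A := by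
  have hcard : Nat.card W = A.card := by
    rw [Nat.card_coe_set_eq, ← Set.ncard_coe_finset]
    congr 1
    ext x
    simpa using hW x
  rw [matchingPolynomial, matchingPolynomialIn, Polynomial.map_sum, hcard,
    ← Finset.sum_fiberwise_of_maps_to (s := matchingsIn G A) (g := Finset.card)
      (t := Finset.range (A.card / 2 + 1)) fun M hM => by
        have := two_mul_card_add_card_uncovered hM
        rw [Finset.mem_range]
        omega]
  refine Finset.sum_congr rfl fun i _ => ?_
  rw [numMatchings_induce G hW, Finset.sum_congr rfl (g := fun _ => (-1) ^ i * X ^ (A.card - 2 * i))]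
  · simp
    ring
  · intro M hM
    obtain ⟨-, rfl⟩ := Finset.mem_filter.1 hM
    have := two_mul_card_add_card_uncovered (Finset.mem_filter.1 hM).1
    rw [show (uncovered A M).card = A.card - 2 * M.card by omega]

/-- The leading term comes from the empty matching. -/
lemma monic_matchingPolynomial {W : Type*} [Finite W] (H : SimpleGraph W) :
    (matchingPolynomial H).Monic := by
  have h0 : numMatchings H 0 = 1 := by
    rw [numMatchings, Set.ncard_eq_one]
    refine ⟨∅, ?_⟩
    ext M
    simp only [Set.mem_ofPred_eq, Finset.card_eq_zero, Set.mem_singleton_iff]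
    constructor
    · exact fun h => h.2.1
    · rintro rfl
      simp
  rw [matchingPolynomial, Finset.sum_range_succ', h0, add_comm]
  simp only [pow_zero, Nat.cast_one, mul_one, C_1, one_mul, mul_zero, Nat.sub_zero]
  refine monic_X_pow_add ?_
  refine (degree_sum_le _ _).trans_lt ((Finset.sup_lt_iff (by exact WithBot.bot_lt_coe _)).2 ?_)
  intro i hi
  refine (degree_C_mul_X_pow_le _ _).trans_lt ?_
  rw [Finset.mem_range] at hi
  exact_mod_cast (by omega : Nat.card W - 2 * (i + 1) < Nat.card W)

end MatchingPolynomial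

/-! ### Symmetry as equality of characteristic polynomials; switching -/

section Spectrum

open Polynomial SimpleGraph

variable {V : Type*} [Fintype V] [DecidableEq V]

lemma charpoly_neg_eq_prod {A : Matrix V V ℝ} (hA : A.IsHermitian) :
    (-A).charpoly = ∏ i, (X - C (-hA.eigenvalues i)) := by
  have h1 : (-A).charpoly = (-1) ^ Fintype.card V * A.charpoly.comp (-X) := by
    rw [Matrix.charpoly, Matrix.charpoly, ← coe_compRingHom_apply, RingHom.map_det, ← Matrix.det_neg]
    congr 1
    ext1 i j
    by_cases h : i = j
    · subst h
      simp
      ring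
    · simp [h]
  rw [h1, hA.charpoly_eq, prod_comp, ← Finset.card_univ, ← Finset.prod_const,
    ← Finset.prod_mul_distrib]
  refine Finset.prod_congr rfl fun i _ => ?_
  simp
  ring

lemma roots_charpoly_neg {A : Matrix V V ℝ} (hA : A.IsHermitian) :
    (-A).charpoly.roots = A.charpoly.roots.map Neg.neg := by
  rw [charpoly_neg_eq_prod hA, hA.roots_charpoly_eq_eigenvalues, roots_prod]
  · simp
  · simp [Finset.prod_ne_zero_iff, X_sub_C_ne_zero, -map_neg]

/-- Both characteristic polynomials split over ℝ and are monic, so they are determined by their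
multisets of roots. -/
lemma count_roots_charpoly_neg_iff {A : Matrix V V ℝ} (hA : A.IsHermitian) :
    (∀ x, A.charpoly.roots.count (-x) = A.charpoly.roots.count x) ↔
      A.charpoly = (-A).charpoly := by
  have hcount : ∀ x, (-A).charpoly.roots.count x = A.charpoly.roots.count (-x) := fun x => by
    rw [roots_charpoly_neg hA]
    conv_lhs => rw [← neg_neg x]
    exact Multiset.count_map_eq_count' _ _ neg_injective _
  constructor
  · intro h
    rw [hA.splits_charpoly.eq_prod_roots_of_monic A.charpoly_monic,
      hA.neg.splits_charpoly.eq_prod_roots_of_monic (-A).charpoly_monic]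
    congr 2
    ext x
    rw [hcount, h]
  · intro h x
    rw [← hcount, ← h]

open Classical in
/-- The extension of a signature to all unordered pairs of vertices. -/
noncomputable def extendSignature {V : Type*} {G : SimpleGraph V} (σ : G.edgeSet → ℤˣ) :
    Sym2 V → ℤˣ :=
  fun e => if h : e ∈ G.edgeSet then σ ⟨e, h⟩ else 1

variable {G : SimpleGraph V}

omit [Fintype V] [DecidableEq V] in
lemma cycleSign_eq_walkSign (σ : G.edgeSet → ℤˣ) {u : V} (C : G.Walk u u) :
    cycleSign σ C = walkSign (extendSignature σ) C := by
  rw [cycleSign, walkSign]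
  conv_rhs => rw [← List.attach_map_subtype_val C.edges, List.map_map]
  congr 1
  refine List.map_congr_left fun f _ => ?_
  simp [extendSignature, C.edges_subset_edgeSet f.2]

omit [Fintype V] [DecidableEq V] in
lemma isHermitian_signedAdjMatrix (σ : G.edgeSet → ℤˣ) : (signedAdjMatrix G σ).IsHermitian := by
  refine Matrix.IsHermitian.ext fun i j => ?_
  by_cases h : G.Adj i j
  · simp [signedAdjMatrix, h, h.symm, Sym2.eq_swap (a := i)]
  · have h' : ¬G.Adj j i := fun h' => h h'.symm
    simp [signedAdjMatrix, h, h']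

lemma charpoly_signedAdjMatrix (σ : G.edgeSet → ℤˣ) :
    (signedAdjMatrix G σ).charpoly = (delMatrix G ∅ (extendSignature σ)).det := by
  rw [Matrix.charpoly]
  congr 1
  ext1 i j
  by_cases hij : i = j
  · subst hij
    simp [signedAdjMatrix, delMatrix]
  · by_cases h : G.Adj i j <;>
      simp [signedAdjMatrix, delMatrix, h, hij, extendSignature]

lemma charpoly_neg_signedAdjMatrix (σ : G.edgeSet → ℤˣ) :
    (-signedAdjMatrix G σ).charpoly =
      (delMatrix G ∅ fun e => -1 * extendSignature σ e).det := by
  rw [Matrix.charpoly]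
  congr 1
  ext1 i j
  by_cases hij : i = j
  · subst hij
    simp [signedAdjMatrix, delMatrix]
  · by_cases h : G.Adj i j <;>
      simp [signedAdjMatrix, delMatrix, h, hij, extendSignature]

lemma isSpectrallySymmetric_iff (σ : G.edgeSet → ℤˣ) :
    IsSpectrallySymmetric G σ ↔ (delMatrix G ∅ (extendSignature σ)).det =
      (delMatrix G ∅ fun e => -1 * extendSignature σ e).det := by
  rw [← charpoly_signedAdjMatrix, ← charpoly_neg_signedAdjMatrix,
    ← count_roots_charpoly_neg_iff (isHermitian_signedAdjMatrix σ), IsSpectrallySymmetric,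
    signedSpectrum]
  refine ⟨fun h x => ?_, fun h x _ => ?_⟩
  -- The definition speaks of eigenvalues only. If `x` is none, apply it to `-x`, or both counts are
  -- zero.
  · by_cases hx : x ∈ (signedAdjMatrix G σ).charpoly.roots
    · convert h x hx
    · by_cases hx' : -x ∈ (signedAdjMatrix G σ).charpoly.roots
      · have := h (-x) hx'
        rw [neg_neg] at this
        convert this.symm
      · rw [Multiset.count_eq_zero_of_notMem hx, Multiset.count_eq_zero_of_notMem hx']
  · convert h x

omit [Fintype V] [DecidableEq V] in
lemma walkSign_neg_one {u v : V} (P : G.Walk u v) :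
    walkSign (fun _ => -1) P = (-1) ^ P.length := by
  simp [walkSign]

omit [Fintype V] [DecidableEq V] in
-- The product telescopes: each passage through an inner vertex contributes a square. On closed
-- walks switching therefore changes nothing.
lemma walkSign_mul_map (ε : V → ℤˣ) {u v : V} (P : G.Walk u v) :
    walkSign (fun e => (e.map ε).mul) P = ε u * ε v := by
  induction P with
  | nil => simp [Int.units_mul_self]
  | @cons u v w h P ih =>
    rw [walkSign_cons, ih]
    simp only [Sym2.map_mk, Sym2.mul_mk]
    rw [mul_assoc, ← mul_assoc (ε v), Int.units_mul_self, one_mul]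

lemma det_delMatrix_switch (ε : V → ℤˣ) (τ : Sym2 V → ℤˣ) :
    (delMatrix G ∅ fun e => (e.map ε).mul * τ e).det = (delMatrix G ∅ τ).det := by
  have h : (delMatrix G ∅ fun e => (e.map ε).mul * τ e) =
      Matrix.of fun i j => ((ε i : ℤ) : ℝ[X]) *
        (Matrix.of fun i j => ((ε j : ℤ) : ℝ[X]) * delMatrix G ∅ τ i j) i j := by
    ext1 i j
    simp only [delMatrix, Matrix.of_apply]
    split_ifs with h1 h2 h2
    · exact absurd h2 (Set.notMem_empty i)
    · subst h1
      rw [← mul_assoc, unit_cast_mul_self, one_mul]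
    · simp [mul_assoc]
    · simp
  rw [h, Matrix.det_mul_column, Matrix.det_mul_row, ← mul_assoc, ← Finset.prod_mul_distrib]
  simp [unit_cast_mul_self]

omit [Fintype V] [DecidableEq V] in
-- Take `ε v` to be the sign of the tree path from a root to `v`; for adjacent vertices one of the
-- two paths extends the other by their edge.
lemma exists_potential {T : SimpleGraph V} (hT : T.IsTree) (τ : Sym2 V → ℤˣ) :
    ∃ ε : V → ℤˣ, ∀ i j, T.Adj i j → ε i * ε j = τ s(i, j) := by
  obtain ⟨r⟩ := hT.connected.nonempty
  choose p hp _ using fun v => hT.existsUnique_path r v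
  have key : ∀ i j (h : T.Adj i j), p j = (p i).concat h →
      walkSign τ (p i) * walkSign τ (p j) = τ s(i, j) := fun i j h hc => by
    rw [hc, walkSign, walkSign, Walk.edges_concat]
    simp [List.concat_eq_append, ← mul_assoc, Int.units_mul_self]
  refine ⟨fun v => walkSign τ (p v), fun i j h => ?_⟩
  by_cases hj : j ∈ (p i).support
  · rw [mul_comm, Sym2.eq_swap]
    exact key j i h.symm (hT.isAcyclic.path_concat (hp j) (hp i) h.symm hj)
  · exact key i j h (hT.isAcyclic.path_concat (hp i) (hp j) h
      (hT.isAcyclic.mem_support_of_ne_mem_support_of_adj_of_isPath (hp j) (hp i) h.symm hj))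

omit [Fintype V] [DecidableEq V] in
lemma exists_switch_eq_one {T : SimpleGraph V} (hT : T.IsTree) (τ : Sym2 V → ℤˣ) :
    ∃ ε : V → ℤˣ, ∀ f ∈ T.edgeSet, (f.map ε).mul * τ f = 1 := by
  obtain ⟨ε, hε⟩ := exists_potential hT τ
  refine ⟨ε, fun f hf => ?_⟩
  induction f with | _ i j =>
  simp [hε i j hf, Int.units_mul_self]

omit [Fintype V] in
/-- The sign of a spanning cycle is the sign of the edge that forms it, after a switching that makes
the spanning tree positive. -/
lemma walkSign_eq_switch {τ : Sym2 V → ℤˣ} {ε : V → ℤˣ} {u : V}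
    {C : G.Walk u u} (hC : C.IsCycle) {e : Sym2 V} (he : e ∈ C.edges)
    (hε : ∀ f ∈ C.edges, f ≠ e → (f.map ε).mul * τ f = 1) :
    walkSign τ C = (e.map ε).mul * τ e := by
  rw [← walkSign_eq_of_nodup (fun f => (f.map ε).mul * τ f) hC.isTrail.edges_nodup he hε,
    walkSign_mul, walkSign_mul_map, Int.units_mul_self, one_mul]

omit [DecidableEq V] in
lemma ncard_edgeSet_of_isTree {T : SimpleGraph V} (hT : T.IsTree) :
    T.edgeSet.ncard + 1 = Nat.card V :=
  (isTree_iff_connected_and_card.1 hT).2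

omit [DecidableEq V] in
-- A spanning tree has two edges fewer than `G`.
lemma eq_or_eq_or_mem_edgeSet {T : SimpleGraph V} (hG : IsKCyclic G 2) (hT : IsSpanningTree G T)
    {e₁ e₂ : Sym2 V} (he : e₁ ≠ e₂) (h₁ : e₁ ∉ T.edgeSet) (h₂ : e₂ ∉ T.edgeSet)
    (h₁' : e₁ ∈ G.edgeSet) (h₂' : e₂ ∈ G.edgeSet) :
    ∀ f ∈ G.edgeSet, f = e₁ ∨ f = e₂ ∨ f ∈ T.edgeSet := by
  have hsub : insert e₁ (insert e₂ T.edgeSet) ⊆ G.edgeSet := by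
    rintro f (rfl | rfl | hf)
    exacts [h₁', h₂', edgeSet_mono hT.1 hf]
  have hcard := ncard_edgeSet_of_isTree hT.2
  have heq := Set.eq_of_subset_of_ncard_le hsub (by
    rw [Set.ncard_insert_of_notMem (by simp [he, h₁]), Set.ncard_insert_of_notMem h₂]
    have := hG.2
    omega)
  intro f hf
  rw [← heq] at hf
  simpa using hf

/-- The signs that are `s` on `e₁`, `t` on `e₂` and positive elsewhere. -/
def pairSign (e₁ e₂ : Sym2 V) (s t : ℤˣ) : Sym2 V → ℤˣ :=
  fun e => if e = e₁ then s else if e = e₂ then t else 1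

/-- The characteristic polynomial depends only on the signs of the two spanning cycles. -/
lemma det_delMatrix_eq_pairSign {T : SimpleGraph V} (hG : IsKCyclic G 2)
    (hT : IsSpanningTree G T) {e₁ e₂ : Sym2 V} (he : e₁ ≠ e₂) {u₁ u₂ : V} {C₁ : G.Walk u₁ u₁}
    {C₂ : G.Walk u₂ u₂} (h₁ : IsSpanningCycle T e₁ C₁) (h₂ : IsSpanningCycle T e₂ C₂)
    (τ : Sym2 V → ℤˣ) :
    (delMatrix G ∅ τ).det =
      (delMatrix G ∅ (pairSign e₁ e₂ (walkSign τ C₁) (walkSign τ C₂))).det := by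
  obtain ⟨ε, hε⟩ := exists_switch_eq_one hT.2 τ
  rw [← det_delMatrix_switch ε τ]
  have hsign : ∀ {u : V} {C : G.Walk u u} {e : Sym2 V}, IsSpanningCycle T e C →
      walkSign τ C = (e.map ε).mul * τ e := fun h =>
    walkSign_eq_switch h.2.1 h.2.2.1 fun f hf hfe => hε f ((h.2.2.2 f hf).resolve_left hfe)
  rw [hsign h₁, hsign h₂]
  congr 1
  refine delMatrix_congr fun i j hij _ _ => ?_
  rcases eq_or_eq_or_mem_edgeSet hG hT he h₁.1 h₂.1 (C₁.edges_subset_edgeSet h₁.2.2.1)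
    (C₂.edges_subset_edgeSet h₂.2.2.1) s(i, j) hij with h | h | h
  · simp [pairSign, h]
  · simp [pairSign, h, he.symm]
  · rw [hε _ h, pairSign, if_neg (ne_of_mem_of_not_mem h h₁.1),
      if_neg (ne_of_mem_of_not_mem h h₂.1)]

end Spectrum

/-! ### Tree exchange and the existence of an admissible tree -/

section SpanningCycles

open SimpleGraph

variable {V : Type*} [Fintype V] {G T : SimpleGraph V}

omit [Fintype V] in
lemma exists_isSpanningCycle (hT : IsSpanningTree G T) {e : Sym2 V} (he : e ∈ G.edgeSet)
    (he' : e ∉ T.edgeSet) : ∃ (u : V) (C : G.Walk u u), IsSpanningCycle T e C := by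
  induction e with | _ a b =>
  obtain ⟨p, hp, -⟩ := hT.2.existsUnique_path b a
  have hedges : (p.mapLe hT.1).edges = p.edges := Walk.edges_mapLe_eq_edges hT.1 p
  have hab : G.Adj a b := he
  refine ⟨a, Walk.cons hab (p.mapLe hT.1), he', ?_, by simp, ?_⟩
  · rw [Walk.cons_isCycle_iff, hedges]
    exact ⟨hp.mapLe hT.1, fun h => he' (p.edges_subset_edgeSet h)⟩
  · intro f hf
    rw [Walk.edges_cons, hedges, List.mem_cons] at hf
    exact hf.imp_right fun h => p.edges_subset_edgeSet h

/-- Exchanging an edge of a spanning cycle for the edge that forms the cycle gives a spanning tree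
again. -/
lemma exists_isSpanningTree_exchange (hT : IsSpanningTree G T) {e f : Sym2 V} {u : V}
    {C : G.Walk u u} (hC : IsSpanningCycle T e C) (hf : f ∈ C.edges) (hfe : f ≠ e) :
    ∃ T' : SimpleGraph V, IsSpanningTree G T' ∧ T'.edgeSet = insert e T.edgeSet \ {f} := by
  have he : e ∈ G.edgeSet := C.edges_subset_edgeSet hC.2.2.1
  set H : SimpleGraph V := T ⊔ fromEdgeSet {e} with hH
  have hHe : H.edgeSet = insert e T.edgeSet := by
    rw [hH, edgeSet_sup, edgeSet_fromEdgeSet, Set.union_comm, Set.insert_eq,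
      Disjoint.sdiff_eq_left (a := {e}) (b := Sym2.diagSet)
        (Set.disjoint_singleton_left.2 (G.not_isDiag_of_mem_edgeSet he))]
  have hfT : f ∈ T.edgeSet := (hC.2.2.2 f hf).resolve_left hfe
  have hCH : ∀ g ∈ C.edges, g ∈ H.edgeSet := fun g hg => by
    rw [hHe]
    exact hC.2.2.2 g hg
  have hbridge : ¬H.IsBridge f := fun h =>
    h.notMem_edges_of_isCycle (hC.2.1.transfer hCH) (by rwa [Walk.edges_transfer])
  have hset : (H.deleteEdges {f}).edgeSet = insert e T.edgeSet \ {f} := by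
    rw [edgeSet_deleteEdges, hHe]
  have hconn : (H.deleteEdges {f}).Connected := by
    have hHc : H.Connected := hT.2.connected.mono le_sup_left
    induction f with | _ x y =>
    exact hHc.connected_delete_edge_of_not_isBridge hbridge
  refine ⟨H.deleteEdges {f}, ⟨?_, isTree_iff_connected_and_card.2 ⟨hconn, ?_⟩⟩, hset⟩
  · rw [← edgeSet_subset_edgeSet, hset]
    rintro g ⟨rfl | hg, -⟩
    exacts [he, edgeSet_mono hT.1 hg]
  · rw [Nat.card_coe_set_eq, hset, Set.ncard_sdiff_singleton_of_mem (Set.mem_insert_of_mem e hfT),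
      Set.ncard_insert_of_notMem hC.1, Nat.add_sub_cancel]
    exact ncard_edgeSet_of_isTree hT.2

omit [Fintype V] in
-- Parity is the sign under the all-negative signature, so switching arguments apply to lengths.
lemma odd_length_iff {u : V} (C : G.Walk u u) : Odd C.length ↔ walkSign (fun _ => -1) C = -1 := by
  rw [walkSign_neg_one]
  rcases Nat.even_or_odd C.length with h | h
  · rw [h.neg_one_pow]
    simp only [← Nat.not_even_iff_odd, h, not_true_eq_false, false_iff]
    decide
  · simp [h.neg_one_pow, h]

/-- If an odd and an even spanning cycle have a common edge, then exchanging it for the edge that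
forms the odd cycle gives two odd spanning cycles. -/
lemma exists_odd_pair_of_common_edge (hT : IsSpanningTree G T) {e₁ e₂ f : Sym2 V} (he : e₁ ≠ e₂)
    {u₁ u₂ : V} {C₁ : G.Walk u₁ u₁} {C₂ : G.Walk u₂ u₂} (h₁ : IsSpanningCycle T e₁ C₁)
    (h₂ : IsSpanningCycle T e₂ C₂) (hodd : Odd C₁.length) (heven : Even C₂.length) (hf₁ : f ∈ C₁.edges)
    (hf₂ : f ∈ C₂.edges) :
    ∃ (T : SimpleGraph V) (u₁ u₂ : V) (C₁ : G.Walk u₁ u₁) (C₂ : G.Walk u₂ u₂),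
      IsSpanningCyclePair T C₁ C₂ ∧ (Even C₁.length ↔ Even C₂.length) := by
  classical
  have hfe₁ : f ≠ e₁ := by
    rintro rfl
    exact (h₂.2.2.2 f hf₂).elim he h₁.1
  have hfe₂ : f ≠ e₂ := by
    rintro rfl
    exact (h₁.2.2.2 f hf₁).elim he.symm h₂.1
  have hfT : f ∈ T.edgeSet := (h₁.2.2.2 f hf₁).resolve_left hfe₁
  obtain ⟨T', hT', hset'⟩ := exists_isSpanningTree_exchange hT h₁ hf₁ hfe₁
  obtain ⟨T'', hT'', hset''⟩ := exists_isSpanningTree_exchange hT h₂ hf₂ hfe₂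
  have he₂ : e₂ ∉ T'.edgeSet := by
    rw [hset']
    rintro ⟨h | h, -⟩
    exacts [he h.symm, h₂.1 h]
  obtain ⟨w, C, hC⟩ := exists_isSpanningCycle hT' (C₂.edges_subset_edgeSet h₂.2.2.1) he₂
  have hC₁ : IsSpanningCycle T' f C₁ := by
    refine ⟨by simp [hset'], h₁.2.1, hf₁, fun g hg => ?_⟩
    by_cases hgf : g = f
    · exact Or.inl hgf
    · exact Or.inr (hset' ▸ ⟨h₁.2.2.2 g hg, hgf⟩)
  have hCT : ∀ g ∈ C.edges, g ≠ e₁ → g = e₂ ∨ (g ∈ T.edgeSet ∧ g ≠ f) := fun g hg hge => by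
    refine (hC.2.2.2 g hg).imp_right fun h => ?_
    rw [hset'] at h
    exact ⟨h.1.resolve_left hge, h.2⟩
  -- Otherwise the cycle `C` would lie in the tree `T''`, which is `T` with `f` exchanged for `e₂`.
  have he₁C : e₁ ∈ C.edges := by
    by_contra hmem
    have hsub : ∀ g ∈ C.edges, g ∈ T''.edgeSet := fun g hg => by
      rw [hset'']
      rcases hCT g hg (ne_of_mem_of_not_mem hg hmem) with rfl | h
      · exact ⟨Or.inl rfl, hfe₂.symm⟩
      · exact ⟨Or.inr h.1, h.2⟩
    exact hT''.2.isAcyclic _ (hC.2.1.transfer hsub)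
  refine ⟨T', u₁, w, C₁, C, ⟨hT', f, e₂, hfe₂, hC₁, hC⟩, ?_⟩
  -- Switch the all-negative signature to be positive on `T`. Then `e₂` is positive as `C₂` is even,
  -- so the sign of `C` is that of `e₁`, which is the sign of the odd cycle `C₁`.
  obtain ⟨ε, hε⟩ := exists_switch_eq_one hT.2 fun _ => -1
  have h1 := walkSign_eq_switch h₁.2.1 h₁.2.2.1 fun g hg hge =>
    hε g ((h₁.2.2.2 g hg).resolve_left hge)
  have h2 := walkSign_eq_switch h₂.2.1 h₂.2.2.1 fun g hg hge =>
    hε g ((h₂.2.2.2 g hg).resolve_left hge)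
  rw [walkSign_neg_one, heven.neg_one_pow] at h2
  have h3 := walkSign_eq_switch (ε := ε) (τ := fun _ => -1) hC.2.1 he₁C fun g hg hge => by
    rcases hCT g hg hge with rfl | h
    · exact h2.symm
    · exact hε g h.1
  rw [← h1, (odd_length_iff C₁).1 hodd] at h3
  simp only [← Nat.not_odd_iff_even, hodd, (odd_length_iff C).2 h3]

/-- A bicyclic graph has a spanning tree whose spanning cycles have lengths of the same parity or no
common edge. -/
lemma exists_admissible_isSpanningCyclePair (hG : IsKCyclic G 2) :
    ∃ (T : SimpleGraph V) (u₁ u₂ : V) (C₁ : G.Walk u₁ u₁) (C₂ : G.Walk u₂ u₂),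
      IsSpanningCyclePair T C₁ C₂ ∧
        ((Even C₁.length ↔ Even C₂.length) ∨ C₁.edges.Disjoint C₂.edges) := by
  obtain ⟨T, hle, htree⟩ := hG.1.exists_isTree_le
  have hT : IsSpanningTree G T := ⟨hle, htree⟩
  have hcard : (G.edgeSet \ T.edgeSet).ncard = 2 := by
    rw [Set.ncard_sdiff (edgeSet_mono hle)]
    have := ncard_edgeSet_of_isTree htree
    have := hG.2
    omega
  obtain ⟨e₁, e₂, he, hset⟩ := Set.ncard_eq_two.1 hcard
  have he₁ : e₁ ∈ G.edgeSet \ T.edgeSet := by simp [hset]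
  have he₂ : e₂ ∈ G.edgeSet \ T.edgeSet := by simp [hset]
  obtain ⟨u₁, C₁, h₁⟩ := exists_isSpanningCycle hT he₁.1 he₁.2
  obtain ⟨u₂, C₂, h₂⟩ := exists_isSpanningCycle hT he₂.1 he₂.2
  by_cases hadm : (Even C₁.length ↔ Even C₂.length) ∨ C₁.edges.Disjoint C₂.edges
  · exact ⟨T, u₁, u₂, C₁, C₂, ⟨hT, e₁, e₂, he, h₁, h₂⟩, hadm⟩
  · obtain ⟨hpar, hdis⟩ := not_or.1 hadm
    obtain ⟨f, hf₁, hf₂⟩ : ∃ f, f ∈ C₁.edges ∧ f ∈ C₂.edges := by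
      by_contra h
      exact hdis fun f hf₁ hf₂ => h ⟨f, hf₁, hf₂⟩
    have : ∃ (T : SimpleGraph V) (u₁ u₂ : V) (C₁ : G.Walk u₁ u₁) (C₂ : G.Walk u₂ u₂),
        IsSpanningCyclePair T C₁ C₂ ∧ (Even C₁.length ↔ Even C₂.length) := by
      rcases Nat.even_or_odd C₁.length with hC₁ | hC₁
      · exact exists_odd_pair_of_common_edge hT he.symm h₂ h₁
          (Nat.not_even_iff_odd.1 fun h => hpar (iff_of_true hC₁ h)) hC₁ hf₂ hf₁
      · exact exists_odd_pair_of_common_edge hT he h₁ h₂ hC₁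
          (Nat.not_odd_iff_even.1 fun h => hpar (iff_of_false (Nat.not_even_iff_odd.2 hC₁)
            (Nat.not_even_iff_odd.2 h))) hf₁ hf₂
    obtain ⟨T, u₁, u₂, C₁, C₂, h, hpar⟩ := this
    exact ⟨T, u₁, u₂, C₁, C₂, h, Or.inl hpar⟩

end SpanningCycles

/-! ### The criterion for two odd cycles and for cycles of different parity -/

section Bicyclic

open Polynomial SimpleGraph

variable {V : Type*} [Fintype V] [DecidableEq V] {G T : SimpleGraph V}

/-- Multiplying the rows of `S` by `X` gives a characteristic matrix, whose determinant is monic. -/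
lemma det_delMatrix_ne_zero (S : Set V) (τ : Sym2 V → ℤˣ) : (delMatrix G S τ).det ≠ 0 := by
  classical
  intro h
  have h1 := Matrix.det_mul_column (fun i => if i ∈ S then (X : ℝ[X]) else 1) (delMatrix G S τ)
  rw [h, mul_zero] at h1
  have h2 : (Matrix.of fun i j => if G.Adj i j ∧ i ∉ S ∧ j ∉ S then
      ((τ s(i, j) : ℤ) : ℝ) else 0).charmatrix =
      Matrix.of fun i j => (if i ∈ S then (X : ℝ[X]) else 1) * delMatrix G S τ i j := by
    ext1 i j
    by_cases hij : i = j
    · subst hij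
      by_cases hi : i ∈ S <;> simp [delMatrix, hi]
    · by_cases hi : i ∈ S <;> by_cases hj : j ∈ S <;> by_cases hadj : G.Adj i j <;>
        simp [delMatrix, hij, hi, hj, hadj]
  rw [← h2] at h1
  exact (Matrix.charpoly_monic _).ne_zero h1

lemma isSpectrallySymmetric_iff_pairSign (hG : IsKCyclic G 2)
    (hT : IsSpanningTree G T) {e₁ e₂ : Sym2 V} (he : e₁ ≠ e₂) {u₁ u₂ : V} {C₁ : G.Walk u₁ u₁}
    {C₂ : G.Walk u₂ u₂} (h₁ : IsSpanningCycle T e₁ C₁) (h₂ : IsSpanningCycle T e₂ C₂)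
    (σ : G.edgeSet → ℤˣ) :
    IsSpectrallySymmetric G σ ↔
      (delMatrix G ∅ (pairSign e₁ e₂ (cycleSign σ C₁) (cycleSign σ C₂))).det =
        (delMatrix G ∅ (pairSign e₁ e₂ ((-1) ^ C₁.length * cycleSign σ C₁)
          ((-1) ^ C₂.length * cycleSign σ C₂))).det := by
  rw [isSpectrallySymmetric_iff, det_delMatrix_eq_pairSign hG hT he h₁ h₂,
    det_delMatrix_eq_pairSign hG hT he h₁ h₂ (fun e => -1 * extendSignature σ e),
    walkSign_mul, walkSign_mul, walkSign_neg_one, walkSign_neg_one, cycleSign_eq_walkSign,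
    cycleSign_eq_walkSign]

omit [Fintype V] [DecidableEq V] in
lemma notMem_edges_of_isSpanningCycle {e₁ e₂ : Sym2 V} (he : e₁ ≠ e₂) (he₁ : e₁ ∉ T.edgeSet)
    {u : V} {C : G.Walk u u} (hC : IsSpanningCycle T e₂ C) : e₁ ∉ C.edges := fun h =>
  (hC.2.2.2 e₁ h).elim he he₁

/-- The coefficient of the sign of a spanning cycle in the characteristic polynomial. -/
lemma coeff_eq_matchingPolynomial {e₁ e₂ : Sym2 V} (he : e₁ ≠ e₂) {u₁ u₂ : V}
    {C₁ : G.Walk u₁ u₁} {C₂ : G.Walk u₂ u₂} (h₁ : IsSpanningCycle T e₁ C₁)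
    (h₂ : IsSpanningCycle T e₂ C₂) {α β γ δ : ℝ[X]}
    (hdet : ∀ τ, (delMatrix G ∅ τ).det = α + ((walkSign τ C₁ : ℤ) : ℝ[X]) * β +
      ((walkSign τ C₂ : ℤ) : ℝ[X]) * γ +
        ((walkSign τ C₁ : ℤ) : ℝ[X]) * ((walkSign τ C₂ : ℤ) : ℝ[X]) * δ) :
    β = -2 * (matchingPolynomial (deleteCycle G C₁)).map (Int.castRingHom ℝ) := by
  have hsum := sum_walkSign_mul_det (𝒯 := Finset.univ) C₁ h₁.2.1 fun _ _ _ _ => Finset.mem_univ _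
  have hset : {y | y ∈ C₁.support} = {y | y ∉ Finset.univ.filter fun x => x ∉ C₁.support} := by
    ext y
    simp
  rw [hset, sum_det_delMatrix_eq_matchingPolynomialIn,
    ← map_matchingPolynomial_induce G (W := {v | v ∉ C₁.support}) (by simp)] at hsum
  have hflip₁ : ∀ τ, walkSign (flipSign e₁ τ) C₁ = -walkSign τ C₁ := fun τ =>
    walkSign_flipSign_of_mem τ h₁.2.1.isTrail.edges_nodup h₁.2.2.1
  have hflip₂ : ∀ τ, walkSign (flipSign e₂ τ) C₂ = -walkSign τ C₂ := fun τ =>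
    walkSign_flipSign_of_mem τ h₂.2.1.isTrail.edges_nodup h₂.2.2.1
  have hflip₁₂ : ∀ τ, walkSign (flipSign e₁ τ) C₂ = walkSign τ C₂ := fun τ =>
    walkSign_flipSign_of_notMem τ (notMem_edges_of_isSpanningCycle he h₁.1 h₂)
  -- After multiplication by the sign of `C₁`, whose square is 1, every term but `β` is odd in `e₁`
  -- or in `e₂`.
  have hz₁ : ∑ τ, ((walkSign τ C₁ : ℤ) : ℝ[X]) * (α + ((walkSign τ C₂ : ℤ) : ℝ[X]) * γ) = 0 :=
    sum_eq_zero_of_flipSign _ e₁ (fun _ _ => Finset.mem_univ _) _ fun τ _ => by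
      rw [hflip₁, hflip₁₂]
      simp
  have hz₂ : ∑ τ, ((walkSign τ C₂ : ℤ) : ℝ[X]) * δ = 0 :=
    sum_eq_zero_of_flipSign _ e₂ (fun _ _ => Finset.mem_univ _) _ fun τ _ => by
      rw [hflip₂]
      simp
  have hexp : ∀ τ, ((walkSign τ C₁ : ℤ) : ℝ[X]) * (delMatrix G ∅ τ).det = β +
      ((walkSign τ C₁ : ℤ) : ℝ[X]) * (α + ((walkSign τ C₂ : ℤ) : ℝ[X]) * γ) +
        ((walkSign τ C₂ : ℤ) : ℝ[X]) * δ := fun τ => by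
    rw [hdet]
    linear_combination (β + ((walkSign τ C₂ : ℤ) : ℝ[X]) * δ) *
      unit_cast_mul_self (R := ℝ[X]) (walkSign τ C₁)
  rw [Finset.sum_congr rfl fun τ _ => hexp τ, Finset.sum_add_distrib, Finset.sum_add_distrib, hz₁,
    hz₂, Finset.sum_const, Finset.card_univ, nsmul_eq_mul, add_zero, add_zero] at hsum
  have hN : (Fintype.card (Sym2 V → ℤˣ) : ℝ[X]) ≠ 0 := Nat.cast_ne_zero.2 Fintype.card_ne_zero
  refine mul_left_cancel₀ hN (hsum.trans ?_)
  rw [deleteCycle]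
  ring

/-- Fourier expansion on the group {±1}²: the coefficients are means against its four characters. -/
lemma exists_coeff_of_units (F : ℤˣ → ℤˣ → ℝ[X]) : ∃ α β γ δ : ℝ[X], ∀ s t, F s t =
    α + ((s : ℤ) : ℝ[X]) * β + ((t : ℤ) : ℝ[X]) * γ +
      ((s : ℤ) : ℝ[X]) * ((t : ℤ) : ℝ[X]) * δ := by
  have h4 : C (1 / 4 : ℝ) * 4 = 1 := by
    rw [show (4 : ℝ[X]) = C 4 from (map_ofNat C 4).symm, ← C_mul]
    norm_num
  refine ⟨C (1 / 4) * (F 1 1 + F 1 (-1) + F (-1) 1 + F (-1) (-1)),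
    C (1 / 4) * (F 1 1 + F 1 (-1) - F (-1) 1 - F (-1) (-1)),
    C (1 / 4) * (F 1 1 - F 1 (-1) + F (-1) 1 - F (-1) (-1)),
    C (1 / 4) * (F 1 1 - F 1 (-1) - F (-1) 1 + F (-1) (-1)), fun s t => ?_⟩
  rcases Int.units_eq_one_or s with rfl | rfl <;> rcases Int.units_eq_one_or t with rfl | rfl <;>
    push_cast
  · linear_combination -F 1 1 * h4
  · linear_combination -F 1 (-1) * h4
  · linear_combination -F (-1) 1 * h4
  · linear_combination -F (-1) (-1) * h4

lemma isSpectrallySymmetric_iff_of_odd (hG : IsKCyclic G 2)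
    (hT : IsSpanningTree G T) {e₁ e₂ : Sym2 V} (he : e₁ ≠ e₂) {u₁ u₂ : V} {C₁ : G.Walk u₁ u₁}
    {C₂ : G.Walk u₂ u₂} (h₁ : IsSpanningCycle T e₁ C₁) (h₂ : IsSpanningCycle T e₂ C₂)
    (σ : G.edgeSet → ℤˣ) (ho₁ : Odd C₁.length) (ho₂ : Odd C₂.length) :
    IsSpectrallySymmetric G σ ↔
      matchingPolynomial (deleteCycle G C₁) = matchingPolynomial (deleteCycle G C₂) ∧
        cycleSign σ C₁ * cycleSign σ C₂ = -1 := by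
  obtain ⟨α, β, γ, δ, hF⟩ := exists_coeff_of_units fun s t =>
    (delMatrix G ∅ (pairSign e₁ e₂ s t)).det
  have hdet := fun τ => (det_delMatrix_eq_pairSign hG hT he h₁ h₂ τ).trans (hF _ _)
  have hβ := coeff_eq_matchingPolynomial he h₁ h₂ hdet
  have hγ := coeff_eq_matchingPolynomial (α := α) (β := γ) (γ := β) (δ := δ) he.symm h₂ h₁ fun τ => by
    rw [hdet]
    ring
  set M₁ := matchingPolynomial (deleteCycle G C₁) with hM₁
  set M₂ := matchingPolynomial (deleteCycle G C₂) with hM₂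
  have hmonic₁ : M₁.Monic := monic_matchingPolynomial _
  have hmonic₂ : M₂.Monic := monic_matchingPolynomial _
  rw [isSpectrallySymmetric_iff_pairSign hG hT he h₁ h₂, ho₁.neg_one_pow, ho₂.neg_one_pow]
  generalize cycleSign σ C₁ = s
  generalize cycleSign σ C₂ = t
  have key : (delMatrix G ∅ (pairSign e₁ e₂ s t)).det =
      (delMatrix G ∅ (pairSign e₁ e₂ (-1 * s) (-1 * t))).det ↔
        ((s : ℤ) : ℤ[X]) * M₁ + ((t : ℤ) : ℤ[X]) * M₂ = 0 := by
    have hs := hF s t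
    have ht := hF (-1 * s) (-1 * t)
    -- `α` and the `δ` term cancel and the odd terms double; with the factor -2 in `β` and `γ` this
    -- gives -4.
    have hdiff : (delMatrix G ∅ (pairSign e₁ e₂ s t)).det -
        (delMatrix G ∅ (pairSign e₁ e₂ (-1 * s) (-1 * t))).det =
          -4 * (((s : ℤ) : ℤ[X]) * M₁ + ((t : ℤ) : ℤ[X]) * M₂).map (Int.castRingHom ℝ) := by
      refine (congrArg₂ _ hs ht).trans ?_
      rw [hβ, hγ, Polynomial.map_add, Polynomial.map_mul, Polynomial.map_mul,
        Polynomial.map_intCast, Polynomial.map_intCast]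
      push_cast
      ring
    rw [← sub_eq_zero, hdiff, mul_eq_zero, or_iff_right (by norm_num),
      Polynomial.map_eq_zero_iff Int.cast_injective]
  have hneg : M₁ + M₂ ≠ 0 := fun h => by
    have h1 := congrArg Polynomial.leadingCoeff (eq_neg_of_add_eq_zero_left h)
    rw [leadingCoeff_neg, hmonic₁.leadingCoeff, hmonic₂.leadingCoeff] at h1
    norm_num at h1
  rw [key]
  rcases Int.units_eq_one_or s with rfl | rfl <;> rcases Int.units_eq_one_or t with rfl | rfl
  · simpa using hneg
  · simp [← sub_eq_add_neg, sub_eq_zero]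
  · simp [neg_add_eq_zero]
  · refine iff_of_false (fun h => ?_) fun h => absurd h.2 (by decide)
    apply hneg
    simpa [← neg_add, -neg_add_rev] using h

/-- If an odd and an even spanning cycle have no common edge, then the characteristic polynomial
changes with the sign of the odd one. -/
lemma det_delMatrix_pairSign_ne (hG : IsKCyclic G 2)
    (hT : IsSpanningTree G T) {e₁ e₂ : Sym2 V} (he : e₁ ≠ e₂) {u₁ u₂ : V} {C₁ : G.Walk u₁ u₁}
    {C₂ : G.Walk u₂ u₂} (h₁ : IsSpanningCycle T e₁ C₁) (h₂ : IsSpanningCycle T e₂ C₂)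
    (hdis : C₁.edges.Disjoint C₂.edges) (τ₀ : Sym2 V → ℤˣ) :
    (delMatrix G ∅ (pairSign e₁ e₂ (walkSign τ₀ C₁) (walkSign τ₀ C₂))).det ≠
      (delMatrix G ∅ (pairSign e₁ e₂ (-1 * walkSign τ₀ C₁) (walkSign τ₀ C₂))).det := by
  intro heq
  -- Only the signs on `C₁` vary. Disjointness fixes the sign of `C₂`, so under `heq` the
  -- characteristic polynomial is constant on `𝒯`.
  set 𝒯 : Finset (Sym2 V → ℤˣ) := Finset.univ.filter fun τ => ∀ e, e ∉ C₁.edges → τ e = τ₀ e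
    with h𝒯def
  have hmem : ∀ τ, τ ∈ 𝒯 ↔ ∀ e, e ∉ C₁.edges → τ e = τ₀ e := fun τ => by simp [h𝒯def]
  have h𝒯 : ∀ e ∈ C₁.edges, ∀ τ ∈ 𝒯, flipSign e τ ∈ 𝒯 := fun e he' τ hτ => by
    rw [hmem] at hτ ⊢
    intro f hf
    rw [flipSign_of_ne τ (ne_of_mem_of_not_mem he' hf |>.symm), hτ f hf]
  have hsum := sum_walkSign_mul_det C₁ h₁.2.1 h𝒯
  have hconst : ∀ τ ∈ 𝒯, (delMatrix G ∅ τ).det = (delMatrix G ∅ τ₀).det := fun τ hτ => by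
    rw [hmem] at hτ
    rw [det_delMatrix_eq_pairSign hG hT he h₁ h₂ τ, det_delMatrix_eq_pairSign hG hT he h₁ h₂ τ₀,
      walkSign_congr C₂ fun e he' => hτ e fun h => hdis h he']
    have h : walkSign τ C₁ = walkSign τ₀ C₁ ∨ walkSign τ C₁ = -1 * walkSign τ₀ C₁ := by
      rcases Int.units_eq_one_or (walkSign τ C₁) with h | h <;>
        rcases Int.units_eq_one_or (walkSign τ₀ C₁) with h' | h' <;> simp [h, h']
    rcases h with h | h
    · rw [h]
    · rw [h, heq]
  have hdel : ∀ τ ∈ 𝒯, (delMatrix G {y | y ∈ C₁.support} τ).det =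
      (delMatrix G {y | y ∈ C₁.support} τ₀).det := fun τ hτ => by
    refine congrArg Matrix.det (delMatrix_congr fun i j _ hi _ => (hmem τ).1 hτ _ fun h => hi ?_)
    exact C₁.fst_mem_support_of_mem_edges h
  have hzero : ∑ τ ∈ 𝒯, ((walkSign τ C₁ : ℤ) : ℝ[X]) * (delMatrix G ∅ τ).det = 0 :=
    sum_eq_zero_of_flipSign 𝒯 e₁ (h𝒯 e₁ h₁.2.2.1) _ fun τ hτ => by
      rw [hconst _ (h𝒯 e₁ h₁.2.2.1 τ hτ), hconst _ hτ,
        walkSign_flipSign_of_mem τ h₁.2.1.isTrail.edges_nodup h₁.2.2.1]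
      simp
  rw [hzero, Finset.sum_congr rfl hdel, Finset.sum_const, nsmul_eq_mul] at hsum
  have hN : (𝒯.card : ℝ[X]) ≠ 0 :=
    Nat.cast_ne_zero.2 (Finset.card_ne_zero_of_mem ((hmem τ₀).2 fun _ _ => rfl))
  exact mul_ne_zero (by norm_num) (mul_ne_zero hN (det_delMatrix_ne_zero _ τ₀)) hsum.symm

lemma not_isSpectrallySymmetric_of_odd_of_even (hG : IsKCyclic G 2)
    (hT : IsSpanningTree G T) {e₁ e₂ : Sym2 V} (he : e₁ ≠ e₂) {u₁ u₂ : V} {C₁ : G.Walk u₁ u₁}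
    {C₂ : G.Walk u₂ u₂} (h₁ : IsSpanningCycle T e₁ C₁) (h₂ : IsSpanningCycle T e₂ C₂)
    (hdis : C₁.edges.Disjoint C₂.edges) (σ : G.edgeSet → ℤˣ) (ho : Odd C₁.length)
    (hev : Even C₂.length) : ¬IsSpectrallySymmetric G σ := by
  rw [isSpectrallySymmetric_iff_pairSign hG hT he h₁ h₂, ho.neg_one_pow, hev.neg_one_pow, one_mul,
    cycleSign_eq_walkSign, cycleSign_eq_walkSign]
  exact det_delMatrix_pairSign_ne hG hT he h₁ h₂ hdis _

end Bicyclic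

end SignedSpectra

theorem mainTheorem8 {V : Type*} [Fintype V] [DecidableEq V] (G : SimpleGraph V)
    (hG : SignedSpectra.IsKCyclic G 2) :
    (∃ (T : SimpleGraph V) (u₁ u₂ : V) (C₁ : G.Walk u₁ u₁) (C₂ : G.Walk u₂ u₂),
      SignedSpectra.IsSpanningCyclePair T C₁ C₂ ∧
        ((Even C₁.length ↔ Even C₂.length) ∨ C₁.edges.Disjoint C₂.edges)) ∧
    ∀ (σ : G.edgeSet → ℤˣ) (T : SimpleGraph V) (u₁ u₂ : V)
      (C₁ : G.Walk u₁ u₁) (C₂ : G.Walk u₂ u₂),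
      SignedSpectra.IsSpanningCyclePair T C₁ C₂ →
      ((Even C₁.length ↔ Even C₂.length) ∨ C₁.edges.Disjoint C₂.edges) →
      (SignedSpectra.IsSpectrallySymmetric G σ ↔
        ((Even C₁.length ∧ Even C₂.length) ∨
          (Odd C₁.length ∧ Odd C₂.length ∧
            SignedSpectra.matchingPolynomial (SignedSpectra.deleteCycle G C₁) =
              SignedSpectra.matchingPolynomial (SignedSpectra.deleteCycle G C₂) ∧
            SignedSpectra.cycleSign σ C₁ * SignedSpectra.cycleSign σ C₂ = -1))) := by
  refine ⟨SignedSpectra.exists_admissible_isSpanningCyclePair hG, ?_⟩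
  rintro σ T u₁ u₂ C₁ C₂ ⟨hT, e₁, e₂, he, h₁, h₂⟩ hadm
  rcases Nat.even_or_odd C₁.length with hC₁ | hC₁ <;>
    rcases Nat.even_or_odd C₂.length with hC₂ | hC₂
  · refine iff_of_true ?_ (Or.inl ⟨hC₁, hC₂⟩)
    rw [SignedSpectra.isSpectrallySymmetric_iff_pairSign hG hT he h₁ h₂, hC₁.neg_one_pow,
      hC₂.neg_one_pow, one_mul, one_mul]
  · have hC₂' := Nat.not_even_iff_odd.2 hC₂
    have hdis := hadm.resolve_left fun h => hC₂' (h.1 hC₁)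
    refine iff_of_false (SignedSpectra.not_isSpectrallySymmetric_of_odd_of_even hG hT he.symm h₂ h₁
      hdis.symm σ hC₂ hC₁) ?_
    rintro (h | h)
    exacts [hC₂' h.2, Nat.not_odd_iff_even.2 hC₁ h.1]
  · have hC₁' := Nat.not_even_iff_odd.2 hC₁
    have hdis := hadm.resolve_left fun h => hC₁' (h.2 hC₂)
    refine iff_of_false (SignedSpectra.not_isSpectrallySymmetric_of_odd_of_even hG hT he h₁ h₂
      hdis σ hC₁ hC₂) ?_
    rintro (h | h)
    exacts [hC₁' h.1, Nat.not_odd_iff_even.2 hC₂ h.2.1]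
  · rw [SignedSpectra.isSpectrallySymmetric_iff_of_odd hG hT he h₁ h₂ σ hC₁ hC₂]
    simp [hC₁, hC₂, Nat.not_even_iff_odd.2 hC₁]
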